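/- Let $R$ be an associative ring with unit. A (left) $\mathcal R$-module is a covariant additive functor from left $R$-modules to abelian groups; right $\mathcal R$-modules are defined in the same way on right $R$-modules. Morphisms of $\mathcal R$-modules are natural transformations, and $\operatorname{Hom}_{\mathcal R}$ denotes the group of all of them; direct limits (over nonempty upward directed sets), kernels, images and exactness of $\mathcal R$-modules are computed at each module. For a right $R$-module $N$ let $\mathcal N$ be the $\mathcal R$-module $\mathcal N(S)=N\otimes_R S$; for a left $R$-module $S$ let $\mathcal S$ be the right $\mathcal R$-module $\mathcal S(N)=N\otimes_R S$. The dual of an $\mathcal R$-module $\mathbb M$ is the right $\mathcal R$-module $\mathbb M^*(N)=\operatorname{Hom}_{\mathcal R}(\mathbb M,\mathcal N)$, and dually the dual of a right $\mathcal R$-module $\mathbb N$ is the $\mathcal R$-module $\mathbb N^*(S)=\operatorname{Hom}_{\mathcal R}(\mathbb N,\mathcal S)$. $\mathbb M$ is reflexive if the natural morphism $\mathbb M\to\mathbb M^{**}$, $m\mapsto\tilde m$, $\tilde m_N(w)=w_S(m)$ for $m\in\mathbb M(S)$, $w\in\mathbb M^*(N)$, is an isomorphism. Theorem. Let $\mathbb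 F$ be an $\mathcal R$-module that preserves direct limits. The following statements are equivalent: (0) $\mathbb F$ preserves direct products (that is, $\mathbb F$ is an FP module). (1) For every direct system $\{\mathbb M_i\}_{i\in I}$ of $\mathcal R$-modules, the natural map $\varinjlim_{i}\operatorname{Hom}_{\mathcal R}(\mathbb F,\mathbb M_i)\to\operatorname{Hom}_{\mathcal R}(\mathbb F,\varinjlim_{i}\mathbb M_i)$ is an isomorphism. (2) $\mathbb F$ is reflexive and $\mathbb F^*$ preserves direct limits. (3) There is an exact sequence of $\mathcal R$-modules $\mathcal P_1^*\to\mathcal P_2^*\to\mathbb F\to 0$ with $P_1,P_2$ finitely presented left $R$-modules. (4) There is an exact sequence of $\mathcal R$-modules $0\to\mathbb F\to\mathcal Q_1\to\mathcal Q_2$ with $Q_1,Q_2$ finitely presented right $R$-modules. -/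

import Mathlib

open CategoryTheory CategoryTheory.Limits
open scoped TensorProduct

universe u v₁ v₂ u₁ u₂ t w w₁ w₂

noncomputable section

namespace ModuleFunctor

/-! ### The tensor product over a (not necessarily commutative) ring

Right `R`-modules are modules over `Rᵐᵒᵖ`, with `m · r = MulOpposite.op r • m`. -/

section Tensor

variable (R : Type u) [Ring R]

/-- The subgroup of `M ⊗_ℤ S` generated by the elements `(m · r) ⊗ s - m ⊗ (r · s)`. -/
def balancedRel (M : Type u) [AddCommGroup M] [Module Rᵐᵒᵖ M]
    (S : Type u) [AddCommGroup S] [Module R S] : AddSubgroup (M ⊗[ℤ] S) :=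
  AddSubgroup.closure {x | ∃ (r : R) (m : M) (s : S),
    x = (MulOpposite.op r • m) ⊗ₜ[ℤ] s - m ⊗ₜ[ℤ] (r • s)}

/-- The abelian group `M ⊗_R S`, for a right `R`-module `M` and a left `R`-module `S`. -/
abbrev BalancedTensor (M : Type u) [AddCommGroup M] [Module Rᵐᵒᵖ M]
    (S : Type u) [AddCommGroup S] [Module R S] : Type u :=
  (M ⊗[ℤ] S) ⧸ balancedRel R M S

/-- The element `m ⊗ s` of `M ⊗_R S`. -/
def balancedTmul {M : Type u} [AddCommGroup M] [Module Rᵐᵒᵖ M]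
    {S : Type u} [AddCommGroup S] [Module R S] (m : M) (s : S) : BalancedTensor R M S :=
  QuotientAddGroup.mk' (balancedRel R M S) (m ⊗ₜ[ℤ] s)

/-- The homomorphism `f ⊗ g : M ⊗_R S → M' ⊗_R S'`. -/
def balancedMap {M M' : Type u} [AddCommGroup M] [Module Rᵐᵒᵖ M]
    [AddCommGroup M'] [Module Rᵐᵒᵖ M'] {S S' : Type u} [AddCommGroup S] [Module R S]
    [AddCommGroup S'] [Module R S'] (f : M →ₗ[Rᵐᵒᵖ] M') (g : S →ₗ[R] S') :
    BalancedTensor R M S →+ BalancedTensor R M' S' :=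
  QuotientAddGroup.map (balancedRel R M S) (balancedRel R M' S')
    (TensorProduct.map f.toAddMonoidHom.toIntLinearMap
      g.toAddMonoidHom.toIntLinearMap).toAddMonoidHom <| by
    rw [balancedRel, AddSubgroup.closure_le]
    rintro x ⟨r, m, s, rfl⟩
    refine AddSubgroup.subset_closure ⟨r, f m, g s, ?_⟩
    simp

@[simp]
theorem balancedMap_tmul {M M' : Type u} [AddCommGroup M] [Module Rᵐᵒᵖ M]
    [AddCommGroup M'] [Module Rᵐᵒᵖ M'] {S S' : Type u} [AddCommGroup S] [Module R S]
    [AddCommGroup S'] [Module R S'] (f : M →ₗ[Rᵐᵒᵖ] M') (g : S →ₗ[R] S') (m : M) (s : S) :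
    balancedMap R f g (balancedTmul R m s) = balancedTmul R (f m) (g s) :=
  rfl

/-- Additive maps out of `M ⊗_R S` are determined by their values on the elements `m ⊗ s`. -/
theorem balanced_hom_ext {M : Type u} [AddCommGroup M] [Module Rᵐᵒᵖ M]
    {S : Type u} [AddCommGroup S] [Module R S] {A : Type w} [AddCommGroup A]
    {f g : BalancedTensor R M S →+ A}
    (h : ∀ m s, f (balancedTmul R m s) = g (balancedTmul R m s)) : f = g := by
  refine AddMonoidHom.ext fun y => ?_
  obtain ⟨x, rfl⟩ := QuotientAddGroup.mk'_surjective (balancedRel R M S) y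
  induction x using TensorProduct.induction_on with
  | zero => simp
  | tmul m s => exact h m s
  | add a b ha hb => simp only [map_add, ha, hb]

/-- The bifunctor `(S, M) ↦ M ⊗_R S`. -/
def tensor : ModuleCat.{u} R ⥤ ModuleCat.{u} Rᵐᵒᵖ ⥤ AddCommGrpCat.{u} where
  obj S :=
    { obj := fun M => AddCommGrpCat.of (BalancedTensor R M S)
      map := fun f => AddCommGrpCat.ofHom (balancedMap R f.hom LinearMap.id)
      map_id := fun _ => AddCommGrpCat.hom_ext (balanced_hom_ext R fun _ _ => rfl)
      map_comp := fun _ _ => AddCommGrpCat.hom_ext (balanced_hom_ext R fun _ _ => rfl) }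
  map g :=
    { app := fun _ => AddCommGrpCat.ofHom (balancedMap R LinearMap.id g.hom)
      naturality := fun _ _ _ => AddCommGrpCat.hom_ext (balanced_hom_ext R fun _ _ => rfl) }
  map_id _ := NatTrans.ext (funext fun _ =>
    AddCommGrpCat.hom_ext (balanced_hom_ext R fun _ _ => rfl))
  map_comp _ _ := NatTrans.ext (funext fun _ =>
    AddCommGrpCat.hom_ext (balanced_hom_ext R fun _ _ => rfl))

end Tensor

/-! ### Morphisms of group-valued functors, and duals

The morphisms from a functor on all modules to another one need not form a set in the universe
of the modules, so duals take values in a larger universe. Morphisms are therefore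
defined between functors with values in abelian groups of possibly different universes. -/

section Hom

variable {C : Type u₁} [Category.{v₁} C] {D : Type u₂} [Category.{v₂} D]

/-- A morphism of functors: a natural family of group homomorphisms `F(S) → G(S)`. -/
@[ext]
structure Hom (F : C ⥤ AddCommGrpCat.{w₁}) (G : C ⥤ AddCommGrpCat.{w₂}) where
  /-- the components -/
  app : ∀ S : C, F.obj S →+ G.obj S
  naturality : ∀ {S S' : C} (f : S ⟶ S') (x : F.obj S),
    app S' (F.map f x) = G.map f (app S x)

namespace Hom

variable {F : C ⥤ AddCommGrpCat.{w₁}} {G : C ⥤ AddCommGrpCat.{w₂}}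

instance : Zero (Hom F G) := ⟨⟨fun _ => 0, fun _ _ => by simp⟩⟩

instance : Add (Hom F G) :=
  ⟨fun a b => ⟨fun S => a.app S + b.app S, fun f x => by simp [a.naturality, b.naturality]⟩⟩

instance : Neg (Hom F G) := ⟨fun a => ⟨fun S => -a.app S, fun f x => by simp [a.naturality]⟩⟩

/-- Morphisms of functors form an abelian group under componentwise addition. -/
instance : AddCommGroup (Hom F G) where
  add_assoc a b c := Hom.ext (funext fun S => add_assoc (a.app S) (b.app S) (c.app S))
  zero_add a := Hom.ext (funext fun S => zero_add (a.app S))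
  add_zero a := Hom.ext (funext fun S => add_zero (a.app S))
  add_comm a b := Hom.ext (funext fun S => add_comm (a.app S) (b.app S))
  neg_add_cancel a := Hom.ext (funext fun S => neg_add_cancel (a.app S))
  nsmul := nsmulRec
  zsmul := zsmulRec

/-- Composition of a morphism of functors with a natural transformation. -/
def postcomp {G' : C ⥤ AddCommGrpCat.{w₂}} (φ : G ⟶ G') : Hom F G →+ Hom F G' where
  toFun a := ⟨fun S => (φ.app S).hom.comp (a.app S), fun f x => by
    simp [a.naturality]⟩
  map_zero' := Hom.ext (funext fun S => AddMonoidHom.comp_zero (φ.app S).hom)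
  map_add' a b := Hom.ext (funext fun S => AddMonoidHom.comp_add (φ.app S).hom (a.app S) (b.app S))

end Hom

/-- The dual of `F` with respect to a bifunctor `T`: the functor `N ↦ Hom(F, T(-, N))`. -/
def dual (T : C ⥤ D ⥤ AddCommGrpCat.{t}) (F : C ⥤ AddCommGrpCat.{w}) :
    D ⥤ AddCommGrpCat.{max u₁ t w} where
  obj N := AddCommGrpCat.of (Hom F (T.flip.obj N))
  map g := AddCommGrpCat.ofHom (Hom.postcomp (T.flip.map g))
  map_id N := by
    refine AddCommGrpCat.hom_ext (AddMonoidHom.ext fun a => Hom.ext (funext fun S => ?_))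
    ext x
    simp [Hom.postcomp]
  map_comp g g' := by
    refine AddCommGrpCat.hom_ext (AddMonoidHom.ext fun a => Hom.ext (funext fun S => ?_))
    ext x
    simp [Hom.postcomp]

/-- The natural morphism `F → F**`, which sends `m ∈ F(S)` to the family of maps
`F*(N) → T(S, N)`, `w ↦ w_S(m)`. -/
def toBidual (T : C ⥤ D ⥤ AddCommGrpCat.{t}) (F : C ⥤ AddCommGrpCat.{w}) :
    Hom F (dual T.flip (dual T F)) where
  app S :=
    { toFun := fun m =>
        (⟨fun N =>
            { toFun := fun a : Hom F (T.flip.obj N) => a.app S m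
              map_zero' := rfl
              map_add' := fun _ _ => rfl },
          fun _ _ => rfl⟩ : Hom (dual T F) (T.flip.flip.obj S))
      map_zero' := Hom.ext (funext fun N => AddMonoidHom.ext fun a : Hom F (T.flip.obj N) =>
        map_zero (a.app S))
      map_add' := fun m m' => Hom.ext (funext fun N =>
        AddMonoidHom.ext fun a : Hom F (T.flip.obj N) => map_add (a.app S) m m') }
  naturality f m := Hom.ext (funext fun N =>
    AddMonoidHom.ext fun a : Hom F (T.flip.obj N) => a.naturality f m)

end Hom

/-! ### Functors of modules -/

section Ring

variable {R : Type u} [Ring R]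

/-- The quasi-coherent functor `S ↦ M ⊗_R S` on left modules, for a right module `M`. -/
abbrev qcLeft (M : ModuleCat.{u} Rᵐᵒᵖ) : ModuleCat.{u} R ⥤ AddCommGrpCat.{u} :=
  (tensor R).flip.obj M

/-- The quasi-coherent functor `N ↦ N ⊗_R P` on right modules, for a left module `P`. -/
abbrev qcRight (P : ModuleCat.{u} R) : ModuleCat.{u} Rᵐᵒᵖ ⥤ AddCommGrpCat.{u} :=
  (tensor R).obj P

/-- The dual `F*(N) = Hom(F, N ⊗_R -)`, a functor on right modules, of a functor on
left modules. -/
abbrev dualOfLeft (F : ModuleCat.{u} R ⥤ AddCommGrpCat.{w}) :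
    ModuleCat.{u} Rᵐᵒᵖ ⥤ AddCommGrpCat.{max (u + 1) w} :=
  dual (tensor R) F

/-- The dual `G*(S) = Hom(G, - ⊗_R S)`, a functor on left modules, of a functor on
right modules. -/
abbrev dualOfRight (G : ModuleCat.{u} Rᵐᵒᵖ ⥤ AddCommGrpCat.{w}) :
    ModuleCat.{u} R ⥤ AddCommGrpCat.{max (u + 1) w} :=
  dual (tensor R).flip G

/-- `F` is reflexive: the natural morphism `F → F**` is an isomorphism. -/
def IsReflexive (F : ModuleCat.{u} R ⥤ AddCommGrpCat.{w}) : Prop :=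
  ∀ S : ModuleCat.{u} R, Function.Bijective
    ((toBidual (tensor R) F : Hom F (dualOfRight (dualOfLeft F))).app S)

/-- `F` preserves direct limits, that is, colimits over (nonempty, upward) directed sets. -/
def PreservesDirectLimits (F : ModuleCat.{u} R ⥤ AddCommGrpCat.{w}) : Prop :=
  ∀ (J : Type u) [Preorder J] [IsDirectedOrder J] [Nonempty J], PreservesColimitsOfShape J F

/-- `F` preserves direct products. -/
def PreservesDirectProducts (F : ModuleCat.{u} R ⥤ AddCommGrpCat.{w}) : Prop :=
  ∀ I : Type u, PreservesLimitsOfShape (Discrete I) F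

/-- `Hom(F, -)` commutes with direct limits of additive functors, that is, for every direct
system of additive functors `M_j` the natural map
`colim Hom(F, M_j) → Hom(F, colim M_j)` is an isomorphism of groups. -/
def HomCommutesWithDirectLimits (F : ModuleCat.{u} R ⥤ AddCommGrpCat.{u}) : Prop :=
  ∀ (J : Type u) [Preorder J] [IsDirectedOrder J] [Nonempty J]
    (M : J ⥤ ModuleCat.{u} R ⥤ AddCommGrpCat.{u}), (∀ j, (M.obj j).Additive) →
    PreservesColimit M (preadditiveCoyoneda.obj (Opposite.op F))

/-- There is an exact sequence `P₁* → P₂* → F → 0`, where `P_i*` is the dual of `- ⊗_R P_i`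
and the `P_i` are finitely presented left modules. Exactness of sequences of functors is
exactness at every module. -/
def HasDualPresentation (F : ModuleCat.{u} R ⥤ AddCommGrpCat.{u}) : Prop :=
  ∃ P₁ P₂ : ModuleCat.{u} R, Module.FinitePresentation R P₁ ∧ Module.FinitePresentation R P₂ ∧
    ∃ (f : Hom (dualOfRight (qcRight P₁)) (dualOfRight (qcRight P₂)))
      (g : Hom (dualOfRight (qcRight P₂)) F), ∀ S : ModuleCat.{u} R,
        Function.Exact (f.app S) (g.app S) ∧ Function.Surjective (g.app S)

/-- There is an exact sequence `0 → F → Q₁ ⊗_R - → Q₂ ⊗_R -`, where the `Q_i` are finitely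
presented right modules. -/
def HasTensorCopresentation (F : ModuleCat.{u} R ⥤ AddCommGrpCat.{u}) : Prop :=
  ∃ Q₁ Q₂ : ModuleCat.{u} Rᵐᵒᵖ,
    Module.FinitePresentation Rᵐᵒᵖ Q₁ ∧ Module.FinitePresentation Rᵐᵒᵖ Q₂ ∧
    ∃ (f : Hom F (qcLeft Q₁)) (g : Hom (qcLeft Q₁) (qcLeft Q₂)), ∀ S : ModuleCat.{u} R,
      Function.Injective (f.app S) ∧ Function.Exact (f.app S) (g.app S)

end Ring

end ModuleFunctor

end

/-!
Call a functor `F` coherent if it is the cokernel of a map `Hom(P₁, -) → Hom(P₂, -)` induced by a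
map `φ : P₂ → P₁` of finitely presented left modules, that is, if there is `x₀ ∈ F(P₂)` such that
every `m ∈ F(S)` is `F(h)(x₀)` for some `h : P₂ → S`, and `F(h)(x₀) = 0` if and only if `h`
factors through `φ` (`IsPresentedBy`, `IsCoherent`). Evaluation at the right module `R` shows that
the dual of `- ⊗ P` is `Hom(P, -)`, so the condition `HasDualPresentation` says that `F` is
coherent (`hasDualPresentation_iff`). Each of the other conditions is compared with coherence.

* The main tool is the transpose of `φ` (`exists_isTransposePair`): there are a map `ψ : N₀ → N'`
  of finitely presented right modules and a tensor `z ∈ N₀ ⊗ P₂` that make the sequences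
  `Hom(P₁, S) → Hom(P₂, S) → N₀ ⊗ S → N' ⊗ S` and `Hom(N', N) → Hom(N₀, N) → N ⊗ P₂ → N ⊗ P₁`
  exact. It is written down by generators and relations, and exactness comes from the criterion
  for the vanishing of a tensor with entries in a presented module
  (`IsPresentation.sum_tmul_eq_zero_iff` and its mirror image). The first sequence embeds a
  coherent `F` in `N₀ ⊗ -` as the kernel of `ψ ⊗ -`; the second one shows that `F*` is presented
  by `ψ`. Hence a coherent functor is the kernel of a map of tensor functors, its dual is coherent
  and so preserves direct limits, and applying the first sequence to morphisms `F* → - ⊗ S` gives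
  reflexivity.
* Tensoring with a finitely presented module preserves direct products, hence so do the kernels
  `0 → F → Q₁ ⊗ - → Q₂ ⊗ -`. It also follows that a reflexive `F` whose dual preserves direct
  limits preserves direct products, since morphisms `F* → - ⊗ S` are then determined by their
  components at finitely presented modules (`IsReflexive.productsBijective`).
* Every module is a direct limit of finitely presented ones, so that a functor `F` that preserves
  direct limits is determined by its values on these (`DeterminedByFP`). If `F` also preserves
  direct products, then the family of all elements of `F` at finitely presented modules is an
  element of the value of `F` at a product, which comes from a finitely presented module; this
  gives a generator `x₀ ∈ F(P₂)`. The kernel of `Hom(P₂, -) → F` has the same properties, so it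
  has a generator too, and `F` is coherent (`ProductsBijective.isCoherent`).
* For coherent `F`, `Hom(F, M)` is the kernel of `M(P₂) → M(P₁)`, so it commutes with direct
  limits. Conversely, if `Hom(F, -)` commutes with direct limits, the quotients of `F` by its
  finitely generated subfunctors have direct limit zero, so one of them is zero and `F` is a
  quotient of some `Hom(P, -)`. It is then the direct limit of the quotients of `Hom(P, -)` by
  finitely generated subfunctors, which are coherent; the identity of `F` factors through one of
  them, so `F` is a retract of a functor that preserves direct products.
-/

noncomputable section

namespace ModuleFunctor

/-! ### Directed colimits and products of abelian groups, elementwise -/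

theorem map_comp_apply {C : Type u₁} [Category.{v₁} C] (F : C ⥤ AddCommGrpCat.{w}) {X Y Z : C}
    (f : X ⟶ Y) (g : Y ⟶ Z) (x : F.obj X) : F.map (f ≫ g) x = F.map g (F.map f x) := by
  rw [F.map_comp]; rfl

theorem map_id_apply {C : Type u₁} [Category.{v₁} C] (F : C ⥤ AddCommGrpCat.{w}) {X : C}
    (x : F.obj X) : F.map (𝟙 X) x = x := by
  rw [F.map_id]; rfl

section Concrete

variable {J : Type u} [Preorder J]

/-- Elementwise criterion for a cocone over a directed system of abelian groups to be a colimit: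
every element comes from some stage, and an element of a stage that dies in the cocone point
already dies at a later stage. -/
structure IsDirectedColimit {D : J ⥤ AddCommGrpCat.{w}} (c : Cocone D) : Prop where
  surj : ∀ x : c.pt, ∃ (j : J) (y : D.obj j), c.ι.app j y = x
  zero : ∀ (j : J) (y : D.obj j), c.ι.app j y = 0 → ∃ (k : J) (h : j ≤ k), D.map (homOfLE h) y = 0

theorem cocone_w_apply {D : J ⥤ AddCommGrpCat.{w}} (c : Cocone D) {j k : J} (h : j ⟶ k)
    (y : D.obj j) : c.ι.app k (D.map h y) = c.ι.app j y := by
  rw [← c.w h]; rfl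

namespace IsDirectedColimit

variable {D : J ⥤ AddCommGrpCat.{w}} {c : Cocone D} [IsDirectedOrder J]

theorem eq_of_eq (hc : IsDirectedColimit c) {i j : J} {x : D.obj i} {y : D.obj j}
    (h : c.ι.app i x = c.ι.app j y) :
    ∃ (k : J) (hi : i ≤ k) (hj : j ≤ k), D.map (homOfLE hi) x = D.map (homOfLE hj) y := by
  obtain ⟨l, hil, hjl⟩ := exists_ge_ge i j
  obtain ⟨k, hlk, hk⟩ := hc.zero l (D.map (homOfLE hil) x - D.map (homOfLE hjl) y) (by
    rw [map_sub, cocone_w_apply, cocone_w_apply, h, sub_self])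
  refine ⟨k, hil.trans hlk, hjl.trans hlk, ?_⟩
  rw [map_sub, sub_eq_zero, ← map_comp_apply, ← map_comp_apply] at hk
  exact hk

/-- A cocone satisfying the elementwise criterion is a colimit. -/
theorem nonempty_isColimit (hc : IsDirectedColimit c) : Nonempty (IsColimit c) := by
  choose i r hr using hc.surj
  have key : ∀ (s : Cocone D) {j k : J} {x : D.obj j} {y : D.obj k},
      c.ι.app j x = c.ι.app k y → s.ι.app j x = s.ι.app k y := by
    intro s j k x y h
    obtain ⟨l, hj, hk, e⟩ := hc.eq_of_eq h
    rw [← cocone_w_apply s (homOfLE hj), e, cocone_w_apply]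
  refine ⟨{
    desc := fun s => AddCommGrpCat.ofHom (AddMonoidHom.mk' (fun x => s.ι.app (i x) (r x)) ?_)
    fac := ?_
    uniq := ?_ }⟩
  · intro x y
    obtain ⟨l, hx, hy⟩ := exists_ge_ge (i x) (i y)
    rw [← cocone_w_apply s (homOfLE hx) (r x), ← cocone_w_apply s (homOfLE hy) (r y), ← map_add]
    refine key s ?_
    rw [hr, map_add, cocone_w_apply, cocone_w_apply, hr, hr]
  · intro s j
    ext x
    exact key s (hr _)
  · intro s m hm
    ext x
    change m x = s.ι.app (i x) (r x)
    rw [← hm]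
    change m x = m (c.ι.app _ _)
    rw [hr]

end IsDirectedColimit

/-- The families that vanish from some index on. -/
def eventuallyZero [Nonempty J] [IsDirectedOrder J] (D : J ⥤ AddCommGrpCat.{w}) :
    AddSubgroup (∀ k : J, D.obj k) where
  carrier := {x | ∀ᶠ k in Filter.atTop, x k = 0}
  zero_mem' := Filter.Eventually.of_forall fun _ => rfl
  add_mem' {x y} hx hy := by
    filter_upwards [hx, hy] with k hx hy
    rw [Pi.add_apply, hx, hy, add_zero]
  neg_mem' {x} hx := by
    filter_upwards [hx] with k hx
    rw [Pi.neg_apply, hx, neg_zero]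

open Classical in
/-- The family that starts with `y` at the index `j`. -/
def startAt (D : J ⥤ AddCommGrpCat.{w}) (j : J) : D.obj j →+ ∀ k : J, D.obj k where
  toFun y k := if h : j ≤ k then D.map (homOfLE h) y else 0
  map_zero' := by ext k; simp
  map_add' x y := by
    ext k
    by_cases h : j ≤ k <;> simp [h]

theorem startAt_apply (D : J ⥤ AddCommGrpCat.{w}) {j k : J} (y : D.obj j) (h : j ≤ k) :
    startAt D j y k = D.map (homOfLE h) y :=
  dif_pos h

/-- The cocone with point the families of elements modulo eventually vanishing ones. It detects
which elements of a directed system die in the colimit. -/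
def germCocone [Nonempty J] [IsDirectedOrder J] (D : J ⥤ AddCommGrpCat.{max u w}) : Cocone D where
  pt := AddCommGrpCat.of ((∀ k : J, D.obj k) ⧸ eventuallyZero D)
  ι :=
    { app := fun j => AddCommGrpCat.ofHom
        ((QuotientAddGroup.mk' (eventuallyZero D)).comp (startAt D j))
      naturality := by
        intro j k h
        ext y
        refine (QuotientAddGroup.eq_iff_sub_mem).mpr ?_
        filter_upwards [Filter.eventually_ge_atTop k] with l hl
        rw [Pi.sub_apply, sub_eq_zero]
        erw [startAt_apply D (D.map h y) hl, startAt_apply D y (h.le.trans hl)]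
        exact (map_comp_apply _ _ _ _).symm }

theorem IsDirectedColimit.of_isColimit [Nonempty J] [IsDirectedOrder J]
    {D : J ⥤ AddCommGrpCat.{max u w}} {c : Cocone D} (hc : IsColimit c) :
    IsDirectedColimit c where
  surj := by
    let A : J → AddSubgroup c.pt := fun j => (c.ι.app j).hom.range
    let H : AddSubgroup c.pt := ⨆ j, A j
    have hH : ∀ x, x ∈ H := by
      have e : AddCommGrpCat.ofHom (QuotientAddGroup.mk' H) =
          (0 : c.pt ⟶ AddCommGrpCat.of (c.pt ⧸ H)) := by
        refine hc.hom_ext fun j => ?_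
        ext y
        exact (QuotientAddGroup.eq_zero_iff _).mpr
          (AddSubgroup.mem_iSup_of_mem j ⟨y, rfl⟩)
      intro x
      exact (QuotientAddGroup.eq_zero_iff x).mp (ConcreteCategory.congr_hom e x)
    intro x
    have hdir : Directed (· ≤ ·) A := by
      intro i j
      obtain ⟨k, hi, hj⟩ := exists_ge_ge i j
      refine ⟨k, ?_, ?_⟩
      · rintro _ ⟨y, rfl⟩
        exact ⟨D.map (homOfLE hi) y, cocone_w_apply c _ _⟩
      · rintro _ ⟨y, rfl⟩
        exact ⟨D.map (homOfLE hj) y, cocone_w_apply c _ _⟩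
    obtain ⟨j, y, hy⟩ := (AddSubgroup.mem_iSup_of_directed hdir).mp (hH x)
    exact ⟨j, y, hy⟩
  zero := by
    intro j y hy
    have h1 : (germCocone D).ι.app j y = 0 := by
      rw [← hc.fac (germCocone D) j]
      change hc.desc (germCocone D) (c.ι.app j y) = 0
      rw [hy, map_zero]
    have h2 : ∀ᶠ k in Filter.atTop, startAt D j y k = 0 :=
      (QuotientAddGroup.eq_zero_iff _).mp h1
    obtain ⟨k, hk, hjk⟩ := (h2.and (Filter.eventually_ge_atTop j)).exists
    exact ⟨k, hjk, by rw [← startAt_apply D y hjk, hk]⟩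

end Concrete

section Products

variable {R : Type u} [Ring R]

/-- The projection from a product of modules to a factor. -/
def prodProj {I : Type u} (S : I → ModuleCat.{u} R) (i : I) :
    ModuleCat.of R (∀ i, S i) ⟶ S i :=
  ModuleCat.ofHom (LinearMap.proj i)

/-- Elementwise form of the preservation of direct products: the map
`F(∏ S_i) → ∏ F(S_i)` is bijective. -/
def ProductsBijective (F : ModuleCat.{u} R ⥤ AddCommGrpCat.{w}) : Prop :=
  ∀ (I : Type u) (S : I → ModuleCat.{u} R), Function.Bijective
    fun (m : F.obj (ModuleCat.of R (∀ i, S i))) (i : I) =>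
      F.map (prodProj S i) m

theorem ProductsBijective.preserves {F : ModuleCat.{u} R ⥤ AddCommGrpCat.{w}}
    (h : ProductsBijective F) : PreservesDirectProducts F := by
  intro I
  suffices H : ∀ S : I → ModuleCat.{u} R, PreservesLimit (Discrete.functor S) F from
    ⟨fun {K} => preservesLimit_of_iso_diagram F (Discrete.natIsoFunctor (F := K)).symm⟩
  intro S
  refine preservesLimit_of_preserves_limit_cone (ModuleCat.productConeIsLimit.{u, u} S) ?_
  choose r hr using fun x => (h I S).2 x
  refine
    { lift := fun s => AddCommGrpCat.ofHom
        (AddMonoidHom.mk' (fun x => r fun i => s.π.app ⟨i⟩ x) fun x y => (h I S).1 ?_)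
      fac := ?_
      uniq := ?_ }
  · rw [hr]
    funext i
    simp only [map_add]
    refine Eq.trans ?_ (map_add (F.map (prodProj S i)).hom _ _).symm
    exact congrArg₂ (· + ·) (congrFun (hr fun i => s.π.app ⟨i⟩ x) i).symm
      (congrFun (hr fun i => s.π.app ⟨i⟩ y) i).symm
  · rintro s ⟨i⟩
    ext x
    exact congrFun (hr fun i => s.π.app ⟨i⟩ x) i
  · intro s m hm
    ext x
    refine (h I S).1 ?_
    refine Eq.trans ?_ (hr fun i => s.π.app ⟨i⟩ x).symm
    funext i
    exact ConcreteCategory.congr_hom (hm ⟨i⟩) x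

theorem PreservesDirectProducts.bijective {F : ModuleCat.{u} R ⥤ AddCommGrpCat.{u}}
    (h : PreservesDirectProducts F) : ProductsBijective F := by
  intro I S
  have := h I
  let c := F.mapCone (ModuleCat.productCone.{u, u} S)
  have hc : IsLimit c := isLimitOfPreserves F (ModuleCat.productConeIsLimit.{u, u} S)
  let c' : Cone (Discrete.functor S ⋙ F) :=
    { pt := AddCommGrpCat.of (∀ i, F.obj (S i))
      π := Discrete.natTrans fun i =>
        AddCommGrpCat.ofHom (Pi.evalAddMonoidHom (fun i => F.obj (S i)) i.as) }
  have hc' : IsLimit c' :=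
    { lift := fun s => AddCommGrpCat.ofHom (AddMonoidHom.mk' (fun x i => s.π.app ⟨i⟩ x)
        fun x y => by funext i; simp)
      fac := fun s j => rfl
      uniq := fun s m hm => by
        ext x i
        exact ConcreteCategory.congr_hom (hm ⟨i⟩) x }
  let e := hc.conePointUniqueUpToIso hc'
  have he : ∀ m i, e.hom m i = c.π.app ⟨i⟩ m := fun m i =>
    ConcreteCategory.congr_hom (hc.conePointUniqueUpToIso_hom_comp hc' ⟨i⟩) m
  have : Function.Bijective e.hom := ConcreteCategory.bijective_of_isIso e.hom
  have e' : (fun (m : F.obj (ModuleCat.of R (∀ i, S i))) (i : I) =>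
      F.map (prodProj S i) m) =
        (e.hom : c.pt → c'.pt) :=
    funext fun m => funext fun i => (he m i).symm
  rw [e']
  exact this

end Products

/-! ### Finitely presented modules and directed colimits of modules -/

section FP

variable {R : Type u} [Ring R]

/-- The free module on a set, as a type synonym of `S →₀ R` with its own algebraic instances, so
that quotients of its submodules are found by instance search. -/
def FreeOn (R : Type u) [Ring R] (S : Type u) : Type u := S →₀ R

instance (S : Type u) : AddCommGroup (FreeOn R S) := inferInstanceAs (AddCommGroup (S →₀ R))

instance (S : Type u) : Module R (FreeOn R S) := inferInstanceAs (Module R (S →₀ R))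

/-- The linear map from the free module on the underlying set of a module that evaluates formal
linear combinations. -/
def FreeOn.eval (S : ModuleCat.{u} R) : FreeOn R S →ₗ[R] S :=
  (Finsupp.linearCombination R (id : S → S) : (S →₀ R) →ₗ[R] S)

/-- The linear combinations of elements of a finite set. -/
def FreeOn.supported {S : Type u} (X : Finset S) : Submodule R (FreeOn R S) :=
  (Finsupp.supported R R (X : Set S) :)

theorem FreeOn.supported_mono {S : Type u} {X Y : Finset S} (h : X ⊆ Y) :
    FreeOn.supported (R := R) X ≤ FreeOn.supported Y :=
  Finsupp.supported_mono (M := R) (R := R) (Finset.coe_subset.mpr h)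

/-- The pairs of a finite set of elements of `S` and a finite set of relations between them. They
index a directed system of finitely presented modules with colimit `S`. -/
structure FPStage (S : ModuleCat.{u} R) where
  /-- the generators -/
  gens : Finset S
  /-- the relations -/
  rels : Finset (FreeOn R S)
  supp : ∀ y ∈ rels, y ∈ FreeOn.supported (R := R) gens
  eval : ∀ y ∈ rels, FreeOn.eval S y = 0

namespace FPStage

variable {S : ModuleCat.{u} R}

instance : Preorder (FPStage S) where
  le a b := a.gens ⊆ b.gens ∧ a.rels ⊆ b.rels
  le_refl _ := ⟨Finset.Subset.refl _, Finset.Subset.refl _⟩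
  le_trans _ _ _ h h' := ⟨h.1.trans h'.1, h.2.trans h'.2⟩

open Classical in
instance : IsDirectedOrder (FPStage S) where
  directed a b := by
    refine ⟨⟨a.gens ∪ b.gens, a.rels ∪ b.rels, ?_, ?_⟩,
      ⟨Finset.subset_union_left, Finset.subset_union_left⟩,
      ⟨Finset.subset_union_right, Finset.subset_union_right⟩⟩
    · intro y hy
      rcases Finset.mem_union.mp hy with hy | hy
      · exact FreeOn.supported_mono Finset.subset_union_left (a.supp y hy)
      · exact FreeOn.supported_mono Finset.subset_union_right (b.supp y hy)
    · intro y hy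
      rcases Finset.mem_union.mp hy with hy | hy
      · exact a.eval y hy
      · exact b.eval y hy

instance : Nonempty (FPStage S) :=
  ⟨⟨∅, ∅, fun _ h => absurd h (Finset.notMem_empty _), fun _ h => absurd h (Finset.notMem_empty _)⟩⟩

/-- The submodule of relations of a stage. -/
def relSubmodule (a : FPStage S) : Submodule R (FreeOn.supported (R := R) a.gens) :=
  (Submodule.span R (a.rels : Set (FreeOn R S))).comap (Submodule.subtype _)

/-- The directed system of finitely presented modules with colimit `S`. -/
def system (S : ModuleCat.{u} R) : FPStage S ⥤ ModuleCat.{u} R where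
  obj a := ModuleCat.of R ((FreeOn.supported a.gens) ⧸ a.relSubmodule)
  map {a b} h := ModuleCat.ofHom (Submodule.mapQ _ _
    (Submodule.inclusion (FreeOn.supported_mono h.le.1))
    fun _ hx => Submodule.span_mono (Finset.coe_subset.mpr h.le.2) hx)
  map_id a := by
    refine ModuleCat.hom_ext (Submodule.linearMap_qext _ (LinearMap.ext fun x => rfl))
  map_comp f g := by
    refine ModuleCat.hom_ext (Submodule.linearMap_qext _ (LinearMap.ext fun x => rfl))

/-- The evaluation of a stage of the directed system in `S`. -/
def toBase (a : FPStage S) : (system S).obj a ⟶ S :=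
  ModuleCat.ofHom (Submodule.liftQ _ ((FreeOn.eval S).comp (Submodule.subtype _)) fun _ hx =>
    (Submodule.span_le (p := LinearMap.ker (FreeOn.eval S))).mpr a.eval hx)

theorem map_toBase {a b : FPStage S} (f : a ⟶ b) : (system S).map f ≫ b.toBase = a.toBase :=
  ModuleCat.hom_ext (Submodule.linearMap_qext _ (LinearMap.ext fun _ => rfl))

/-- The evaluation of the stages of the directed system in `S`. -/
def cocone (S : ModuleCat.{u} R) : Cocone (system S) where
  pt := S
  ι :=
    { app := fun a => a.toBase
      naturality := fun _ _ f => map_toBase f }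

theorem finitePresentation (a : FPStage S) : Module.FinitePresentation R ((system S).obj a) := by
  have e := (Finsupp.supportedEquivFinsupp (R := R) (M := R) (a.gens : Set S))
  have : Module.Finite R (FreeOn.supported (R := R) a.gens) :=
    Module.Finite.equiv e.symm
  have : Module.Free R (FreeOn.supported (R := R) a.gens) :=
    Module.Free.of_equiv e.symm
  change Module.FinitePresentation R (_ ⧸ a.relSubmodule)
  refine Module.finitePresentation_of_free_of_surjective a.relSubmodule.mkQ
    (Submodule.mkQ_surjective _) ?_
  rw [Submodule.ker_mkQ]
  refine Submodule.fg_of_fg_map_injective (Submodule.subtype _) (Submodule.subtype_injective _) ?_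
  rw [relSubmodule, Submodule.map_comap_eq_of_le]
  · exact ⟨a.rels, rfl⟩
  · rw [Submodule.range_subtype, Submodule.span_le]
    exact a.supp

theorem isDirectedColimit (S : ModuleCat.{u} R) :
    IsDirectedColimit ((forget₂ (ModuleCat.{u} R) AddCommGrpCat.{u}).mapCocone (cocone S)) where
  surj x := by
    let a : FPStage S := ⟨{x}, ∅, fun _ h => absurd h (Finset.notMem_empty _),
      fun _ h => absurd h (Finset.notMem_empty _)⟩
    refine ⟨a, Submodule.Quotient.mk ⟨Finsupp.single x 1,
      Finsupp.single_mem_supported R 1 (Finset.mem_coe.mpr (Finset.mem_singleton_self x))⟩, ?_⟩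
    exact (Finsupp.linearCombination_single R (v := (id : S → S)) 1 x).trans (one_smul R _)
  zero a y hy := by
    classical
    obtain ⟨⟨z, hz⟩, rfl⟩ := Submodule.Quotient.mk_surjective _ y
    have hz0 : FreeOn.eval S z = 0 := hy
    refine ⟨⟨a.gens, insert z a.rels, ?_, ?_⟩, ⟨Finset.Subset.refl _, Finset.subset_insert _ _⟩, ?_⟩
    · intro y hy
      rcases Finset.mem_insert.mp hy with rfl | hy
      · exact hz
      · exact a.supp y hy
    · intro y hy
      rcases Finset.mem_insert.mp hy with rfl | hy
      · exact hz0
      · exact a.eval y hy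
    · refine (Submodule.Quotient.mk_eq_zero _).mpr ?_
      exact Submodule.subset_span (Finset.mem_coe.mpr (Finset.mem_insert_self _ _))

end FPStage

theorem IsDirectedColimit.nonempty_isColimit_module {J : Type u} [Preorder J] [IsDirectedOrder J]
    [Nonempty J] {D : J ⥤ ModuleCat.{u} R} {c : Cocone D}
    (hc : IsDirectedColimit ((forget₂ (ModuleCat.{u} R) AddCommGrpCat.{u}).mapCocone c)) :
    Nonempty (IsColimit c) :=
  have : ReflectsColimit D (forget₂ (ModuleCat.{u} R) AddCommGrpCat.{u}) :=
    reflectsColimit_of_reflectsIsomorphisms _ _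
  hc.nonempty_isColimit.map fun h => isColimitOfReflects _ h

theorem IsDirectedColimit.of_isColimit_module {J : Type u} [Preorder J] [IsDirectedOrder J]
    [Nonempty J] {D : J ⥤ ModuleCat.{u} R} {c : Cocone D} (hc : IsColimit c) :
    IsDirectedColimit ((forget₂ (ModuleCat.{u} R) AddCommGrpCat.{u}).mapCocone c) :=
  .of_isColimit.{u, u} (isColimitOfPreserves _ hc)

section Lifting

variable {J : Type u} [Preorder J] {D : J ⥤ ModuleCat.{u} R} {c : Cocone D}

theorem module_map_map {i j k : J} (h : i ⟶ j) (h' : j ⟶ k)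
    (y : D.obj i) : D.map h' (D.map h y) = D.map (h ≫ h') y := by
  rw [D.map_comp]; rfl

theorem module_cocone_w {j k : J} (h : j ⟶ k)
    (y : D.obj j) : c.ι.app k (D.map h y) = c.ι.app j y := by
  rw [← c.w h]; rfl

variable [IsDirectedOrder J] [Nonempty J]

theorem exists_forall_of_finite {κ : Type*} [Finite κ] {j : J} {p : κ → J → Prop}
    (hp : ∀ r k l, k ≤ l → p r k → p r l) (h : ∀ r, ∃ k, j ≤ k ∧ p r k) :
    ∃ k, j ≤ k ∧ ∀ r, p r k := by
  have : ∀ᶠ k in Filter.atTop, ∀ r, p r k := Filter.eventually_all.mpr fun r => by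
    obtain ⟨k, -, hk⟩ := h r
    exact (Filter.eventually_ge_atTop k).mono fun l hl => hp r k l hl hk
  obtain ⟨k, hk, hjk⟩ := (this.and (Filter.eventually_ge_atTop j)).exists
  exact ⟨k, hjk, hk⟩

/-- A finite family of elements of a directed colimit comes from one stage, which can be
chosen arbitrarily late. -/
theorem IsDirectedColimit.exists_lift_family
    (hc : IsDirectedColimit ((forget₂ (ModuleCat.{u} R) AddCommGrpCat.{u}).mapCocone c))
    {κ : Type*} [Finite κ] (j : J) (x : κ → c.pt) :
    ∃ (k : J) (_ : j ≤ k) (y : κ → D.obj k), ∀ r, c.ι.app k (y r) = x r := by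
  obtain ⟨k, hjk, hk⟩ := exists_forall_of_finite (j := j)
    (p := fun r k => ∃ y : D.obj k, c.ι.app k y = x r)
    (fun r k l hkl ⟨y, hy⟩ => ⟨D.map (homOfLE hkl) y, (module_cocone_w (homOfLE hkl) y).trans hy⟩)
    (fun r => by
      obtain ⟨i, y, hy⟩ := hc.surj (x r)
      obtain ⟨k, hik, hjk⟩ := exists_ge_ge i j
      exact ⟨k, hjk, D.map (homOfLE hik) y, (module_cocone_w (homOfLE hik) y).trans hy⟩)
  choose y hy using hk
  exact ⟨k, hjk, y, hy⟩

/-- A finite family of elements of a stage that die in the colimit dies at one stage. -/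
theorem IsDirectedColimit.exists_zero_family
    (hc : IsDirectedColimit ((forget₂ (ModuleCat.{u} R) AddCommGrpCat.{u}).mapCocone c))
    {κ : Type*} [Finite κ] {j : J} (x : κ → D.obj j) (hx : ∀ r, c.ι.app j (x r) = 0) :
    ∃ (k : J) (h : j ≤ k), ∀ r, D.map (homOfLE h) (x r) = 0 := by
  obtain ⟨k, hjk, hk⟩ := exists_forall_of_finite (j := j)
    (p := fun r k => ∃ h : j ≤ k, D.map (homOfLE h) (x r) = 0)
    (fun r k l hkl ⟨h, hy⟩ => ⟨h.trans hkl, by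
      rw [← homOfLE_comp h hkl, ← module_map_map, hy, map_zero]⟩)
    (fun r => by
      obtain ⟨k, h, hk⟩ := hc.zero j (x r) (hx r)
      exact ⟨k, h, h, hk⟩)
  exact ⟨k, hjk, fun r => (hk r).2⟩

/-- A map from a finitely presented module to a directed colimit factors through a stage. -/
theorem IsDirectedColimit.exists_factor
    (hc : IsDirectedColimit ((forget₂ (ModuleCat.{u} R) AddCommGrpCat.{u}).mapCocone c))
    {P : ModuleCat.{u} R} (hP : Module.FinitePresentation R P) (h : P ⟶ c.pt) :
    ∃ (j : J) (h' : P ⟶ D.obj j), h' ≫ c.ι.app j = h := by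
  obtain ⟨n, m, f, g, hf, hfg⟩ := Module.FinitePresentation.exists_fin' R P
  obtain ⟨j, -, y, hy⟩ := hc.exists_lift_family (Classical.arbitrary J)
    fun i : Fin n => h (f (Pi.single i 1))
  let H : (Fin n → R) →ₗ[R] D.obj j := Fintype.linearCombination R y
  have hH : (c.ι.app j).hom ∘ₗ H = h.hom ∘ₗ f := by
    refine LinearMap.pi_ext' fun i => LinearMap.ext_ring ?_
    simp only [LinearMap.comp_apply, LinearMap.single_apply]
    rw [Fintype.linearCombination_apply_single, one_smul]
    exact hy i
  obtain ⟨k, hjk, hk⟩ := hc.exists_zero_family (fun r : Fin m => H (g (Pi.single r 1))) fun r => by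
    refine (LinearMap.congr_fun hH _).trans ?_
    rw [LinearMap.comp_apply, hfg.apply_apply_eq_zero, map_zero]
  let H' := (D.map (homOfLE hjk)).hom ∘ₗ H
  have hH' : H' ∘ₗ g = 0 := LinearMap.pi_ext' fun r => LinearMap.ext_ring (hk r)
  have hker : LinearMap.ker f ≤ LinearMap.ker H' := by
    intro x hx
    obtain ⟨z, rfl⟩ := (hfg x).mp hx
    exact LinearMap.congr_fun hH' z
  let e := f.quotKerEquivOfSurjective hf
  refine ⟨k, ModuleCat.ofHom ((Submodule.liftQ _ H' hker) ∘ₗ e.symm.toLinearMap), ?_⟩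
  ext x
  obtain ⟨x, rfl⟩ := hf x
  have : e.symm (f x) = Submodule.Quotient.mk x := by
    rw [LinearEquiv.symm_apply_eq]; rfl
  change c.ι.app k (Submodule.liftQ _ H' hker (e.symm (f x))) = h (f x)
  rw [this]
  change c.ι.app k (D.map (homOfLE hjk) (H x)) = _
  rw [module_cocone_w]
  exact LinearMap.congr_fun hH x

/-- A map from a finitely presented module to a stage that dies in the colimit dies later. -/
theorem IsDirectedColimit.exists_zero
    (hc : IsDirectedColimit ((forget₂ (ModuleCat.{u} R) AddCommGrpCat.{u}).mapCocone c))
    {P : ModuleCat.{u} R} (hP : Module.FinitePresentation R P) {j : J} (h : P ⟶ D.obj j)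
    (hh : h ≫ c.ι.app j = 0) : ∃ (k : J) (hjk : j ≤ k), h ≫ D.map (homOfLE hjk) = 0 := by
  obtain ⟨n, _, f, -, hf, -⟩ := Module.FinitePresentation.exists_fin' R P
  obtain ⟨k, hjk, hk⟩ := hc.exists_zero_family (fun i : Fin n => h (f (Pi.single i 1))) fun i =>
    ConcreteCategory.congr_hom hh (f (Pi.single i 1))
  refine ⟨k, hjk, ModuleCat.hom_ext ?_⟩
  have : (D.map (homOfLE hjk)).hom ∘ₗ h.hom ∘ₗ f = 0 :=
    LinearMap.pi_ext' fun r => LinearMap.ext_ring (hk r)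
  ext x
  obtain ⟨x, rfl⟩ := hf x
  exact LinearMap.congr_fun this x

end Lifting

/-- The functor `F` is determined by its values on finitely presented modules: its elements
come from finitely presented modules, and so do the reasons for their vanishing. Functors that
preserve direct limits have this property. -/
structure DeterminedByFP (F : ModuleCat.{u} R ⥤ AddCommGrpCat.{w}) : Prop where
  lift : ∀ (S : ModuleCat.{u} R) (x : F.obj S), ∃ (P : ModuleCat.{u} R)
    (_ : Module.FinitePresentation R P) (f : P ⟶ S) (y : F.obj P), F.map f y = x
  zero : ∀ (P S : ModuleCat.{u} R), Module.FinitePresentation R P → ∀ (f : P ⟶ S) (y : F.obj P),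
    F.map f y = 0 → ∃ (P' : ModuleCat.{u} R) (_ : Module.FinitePresentation R P')
      (g : P ⟶ P') (h : P' ⟶ S), g ≫ h = f ∧ F.map g y = 0

theorem PreservesDirectLimits.determinedByFP {F : ModuleCat.{u} R ⥤ AddCommGrpCat.{max u w}}
    (hF : PreservesDirectLimits F) : DeterminedByFP F := by
  have key : ∀ S, IsDirectedColimit (F.mapCocone (FPStage.cocone S)) := fun S => by
    have := hF (FPStage S)
    exact .of_isColimit.{u, w}
      (isColimitOfPreserves F (FPStage.isDirectedColimit S).nonempty_isColimit_module.some)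
  constructor
  · intro S x
    obtain ⟨j, y, hy⟩ := (key S).surj x
    exact ⟨_, FPStage.finitePresentation j, (FPStage.cocone S).ι.app j, y, hy⟩
  · intro P S hP f y hy
    obtain ⟨j, h, hh⟩ : ∃ (j : FPStage S) (h : P ⟶ (FPStage.system S).obj j), h ≫ j.toBase = f :=
      (FPStage.isDirectedColimit S).exists_factor hP f
    obtain ⟨k, hjk, hk⟩ := (key S).zero j (F.map h y) (by
      refine Eq.trans ?_ hy
      rw [← hh, map_comp_apply]
      rfl)
    refine ⟨_, FPStage.finitePresentation k, h ≫ (FPStage.system S).map (homOfLE hjk),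
      k.toBase, ?_, ?_⟩
    · rw [Category.assoc, FPStage.map_toBase, hh]
    · rw [map_comp_apply]
      exact hk

/-- A set of representatives of finitely presented modules: numbers of generators with finite sets
of relations. -/
def FPIndex (R : Type u) : Type u :=
  Σ n : ℕ, Finset (Fin n → R)

/-- The finitely presented module with the given generators and relations. -/
abbrev fpMod (i : FPIndex R) : ModuleCat.{u} R :=
  ModuleCat.of R ((Fin i.1 → R) ⧸ Submodule.span R (i.2 : Set (Fin i.1 → R)))

theorem finitePresentation_fpMod (i : FPIndex R) : Module.FinitePresentation R (fpMod i) :=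
  Module.finitePresentation_of_free_of_surjective (Submodule.mkQ _) (Submodule.mkQ_surjective _)
    (by rw [Submodule.ker_mkQ]; exact ⟨i.2, rfl⟩)

theorem exists_iso_fpMod {P : ModuleCat.{u} R} (hP : Module.FinitePresentation R P) :
    ∃ i : FPIndex R, Nonempty (P ≅ fpMod i) := by
  obtain ⟨n, K, e, s, hs⟩ := Module.FinitePresentation.exists_fin R P
  subst hs
  exact ⟨⟨n, s⟩, ⟨e.toModuleIso⟩⟩

end FP

/-! ### Presentations by generators and relations -/

section Presentation

variable {A : Type u} [Ring A] {P : Type u} [AddCommGroup P] [Module A P]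
  {ι κ : Type} [Fintype ι] [Fintype κ]

/-- The elements `p i` generate the module `P`, and the rows of `C` generate the relations
between them. -/
structure IsPresentation (p : ι → P) (C : κ → ι → A) : Prop where
  exists_coeff : ∀ x : P, ∃ a : ι → A, ∑ i, a i • p i = x
  sum_eq_zero_iff : ∀ a : ι → A, ∑ i, a i • p i = 0 ↔ ∃ b : κ → A, ∀ i, a i = ∑ r, b r * C r i

namespace IsPresentation

variable {p : ι → P} {C : κ → ι → A}

theorem rel (hp : IsPresentation p C) (r : κ) : ∑ i, C r i • p i = 0 := by
  classical
  exact (hp.sum_eq_zero_iff _).mpr ⟨Pi.single r 1, fun i => by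
    rw [Finset.sum_eq_single r] <;> simp +contextual⟩

/-- The map out of a presented module given by images of the generators that satisfy the
relations. -/
theorem exists_desc (hp : IsPresentation p C) {S : Type u} [AddCommGroup S] [Module A S]
    (y : ι → S) (hy : ∀ r, ∑ i, C r i • y i = 0) : ∃ h : P →ₗ[A] S, ∀ i, h (p i) = y i := by
  classical
  have hs : Function.Surjective (Fintype.linearCombination A p) := hp.exists_coeff
  have hker : LinearMap.ker (Fintype.linearCombination A p) ≤
      LinearMap.ker (Fintype.linearCombination A y) := by
    intro a ha
    obtain ⟨b, hb⟩ := (hp.sum_eq_zero_iff a).mp ha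
    change ∑ i, a i • y i = 0
    simp_rw [hb, Finset.sum_smul, mul_smul]
    rw [Finset.sum_comm]
    simp_rw [← Finset.smul_sum, hy, smul_zero, Finset.sum_const_zero]
  let e := (Fintype.linearCombination A p).quotKerEquivOfSurjective hs
  refine ⟨(Submodule.liftQ _ _ hker) ∘ₗ e.symm.toLinearMap, fun i => ?_⟩
  have h1 : e.symm (p i) = Submodule.Quotient.mk (Pi.single i 1) := by
    rw [LinearEquiv.symm_apply_eq]
    change _ = Fintype.linearCombination A p (Pi.single i 1)
    rw [Fintype.linearCombination_apply_single, one_smul]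
  change Submodule.liftQ _ _ hker (e.symm (p i)) = y i
  rw [h1]
  change Fintype.linearCombination A y (Pi.single i 1) = _
  rw [Fintype.linearCombination_apply_single, one_smul]

theorem hom_ext (hp : IsPresentation p C) {S : Type u} [AddCommGroup S] [Module A S]
    {f g : P →ₗ[A] S} (h : ∀ i, f (p i) = g (p i)) : f = g := by
  ext x
  obtain ⟨a, rfl⟩ := hp.exists_coeff x
  simp [h]

end IsPresentation

theorem exists_isPresentation [Module.FinitePresentation A P] :
    ∃ (n m : ℕ) (p : Fin n → P) (C : Fin m → Fin n → A), IsPresentation p C := by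
  obtain ⟨n, m, f, g, hf, hfg⟩ := Module.FinitePresentation.exists_fin' A P
  have hf' : ∀ a, f a = ∑ i, a i • f (Pi.single i 1) := fun a => by
    conv_lhs => rw [pi_eq_sum_univ' a]
    simp
  have hg' : ∀ b, g b = ∑ i, b i • g (Pi.single i 1) := fun a => by
    conv_lhs => rw [pi_eq_sum_univ' a]
    simp
  refine ⟨n, m, fun i => f (Pi.single i 1), fun r => g (Pi.single r 1), fun x => ?_, fun a => ?_⟩
  · obtain ⟨a, rfl⟩ := hf x
    exact ⟨a, (hf' a).symm⟩
  · rw [← hf', hfg]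
    refine exists_congr fun b => ?_
    rw [hg', eq_comm, funext_iff]
    simp

/-- The module with given generators and relations. -/
abbrev Presented (C : κ → ι → A) : Type u :=
  (ι → A) ⧸ Submodule.span A (Set.range C)

namespace Presented

open Classical in
/-- The generators of a presented module. -/
def gen (C : κ → ι → A) (i : ι) : Presented C :=
  Submodule.Quotient.mk (Pi.single i 1)

theorem isPresentation (C : κ → ι → A) : IsPresentation (gen C) C := by
  classical
  have key : ∀ a : ι → A, ∑ i, a i • gen C i = Submodule.Quotient.mk a := fun a => by
    conv_rhs => rw [pi_eq_sum_univ' a]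
    change _ = Submodule.mkQ (Submodule.span A (Set.range C)) _
    rw [map_sum]
    refine Finset.sum_congr rfl fun i _ => ?_
    rw [map_smul]
    congr 2
  refine ⟨fun x => ?_, fun a => ?_⟩
  · obtain ⟨a, rfl⟩ := Submodule.Quotient.mk_surjective _ x
    exact ⟨a, key a⟩
  · rw [key, Submodule.Quotient.mk_eq_zero, Submodule.mem_span_range_iff_exists_fun]
    refine exists_congr fun b => ?_
    rw [eq_comm, funext_iff]
    simp

theorem finitePresentation (C : κ → ι → A) : Module.FinitePresentation A (Presented C) :=
  Module.finitePresentation_of_free_of_surjective (Submodule.mkQ _) (Submodule.mkQ_surjective _)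
    (by rw [Submodule.ker_mkQ]; exact Submodule.fg_span (Set.finite_range C))

end Presented

end Presentation

/-! ### Vanishing of elements of a tensor product with a presented module -/

section BalancedTensor

variable {R : Type u} [Ring R] {M : Type u} [AddCommGroup M] [Module Rᵐᵒᵖ M]
  {S : Type u} [AddCommGroup S] [Module R S]

/-- `m ⊗ s` as a biadditive map. -/
def tmulHom : M →+ S →+ BalancedTensor R M S :=
  AddMonoidHom.mk' (fun m => AddMonoidHom.mk' (fun s => balancedTmul R m s)
    fun s s' => by simp only [balancedTmul, TensorProduct.tmul_add, map_add])
    fun m m' => by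
      ext s
      simp only [balancedTmul, TensorProduct.add_tmul, map_add, AddMonoidHom.mk'_apply,
        AddMonoidHom.add_apply]

theorem add_balancedTmul (m m' : M) (s : S) :
    balancedTmul R (m + m') s = balancedTmul R m s + balancedTmul R m' s :=
  congrArg (fun f : S →+ BalancedTensor R M S => f s) (map_add tmulHom m m')

theorem balancedTmul_add (m : M) (s s' : S) :
    balancedTmul R m (s + s') = balancedTmul R m s + balancedTmul R m s' :=
  map_add (tmulHom m) s s'

theorem zero_balancedTmul (s : S) : balancedTmul R (0 : M) s = 0 :=
  congrArg (fun f : S →+ BalancedTensor R M S => f s) (map_zero tmulHom)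

theorem balancedTmul_zero (m : M) : balancedTmul R m (0 : S) = 0 :=
  map_zero (tmulHom m)

theorem sum_balancedTmul {ι : Type*} (t : Finset ι) (m : ι → M) (s : S) :
    balancedTmul R (∑ i ∈ t, m i) s = ∑ i ∈ t, balancedTmul R (m i) s :=
  map_sum ((AddMonoidHom.eval s).comp (tmulHom (R := R) (M := M) (S := S))) m t

theorem balancedTmul_sum {ι : Type*} (t : Finset ι) (m : M) (s : ι → S) :
    balancedTmul R m (∑ i ∈ t, s i) = ∑ i ∈ t, balancedTmul R m (s i) :=
  map_sum (tmulHom m) s t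

theorem smul_balancedTmul (r : R) (m : M) (s : S) :
    balancedTmul R (MulOpposite.op r • m) s = balancedTmul R m (r • s) := by
  refine QuotientAddGroup.eq_iff_sub_mem.mpr ?_
  exact AddSubgroup.subset_closure ⟨r, m, s, rfl⟩

theorem op_smul_balancedTmul (r : Rᵐᵒᵖ) (m : M) (s : S) :
    balancedTmul R (r • m) s = balancedTmul R m (r.unop • s) :=
  smul_balancedTmul r.unop m s

/-- The homomorphism out of `M ⊗_R S` given by a balanced biadditive map. -/
def balancedLift {B : Type u} [AddCommGroup B] (b : M →+ S →+ B)
    (hb : ∀ (r : R) m s, b (MulOpposite.op r • m) s = b m (r • s)) : BalancedTensor R M S →+ B :=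
  QuotientAddGroup.lift (balancedRel R M S)
    (TensorProduct.liftAddHom b fun n m s => by simp) <| by
    rw [balancedRel, AddSubgroup.closure_le]
    rintro x ⟨r, m, s, rfl⟩
    change TensorProduct.liftAddHom b _ _ = 0
    rw [map_sub, TensorProduct.liftAddHom_tmul, TensorProduct.liftAddHom_tmul, hb, sub_self]

theorem balancedLift_tmul {B : Type u} [AddCommGroup B] (b : M →+ S →+ B)
    (hb : ∀ (r : R) m s, b (MulOpposite.op r • m) s = b m (r • s)) (m : M) (s : S) :
    balancedLift b hb (balancedTmul R m s) = b m s :=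
  rfl

theorem balanced_induction {p : BalancedTensor R M S → Prop} (x : BalancedTensor R M S)
    (h0 : p 0) (ht : ∀ m s, p (balancedTmul R m s)) (ha : ∀ x y, p x → p y → p (x + y)) : p x := by
  obtain ⟨x, rfl⟩ := QuotientAddGroup.mk'_surjective (balancedRel R M S) x
  induction x using TensorProduct.induction_on with
  | zero => rw [map_zero]; exact h0
  | tmul m s => exact ht m s
  | add a b ha' hb' => rw [map_add]; exact ha _ _ ha' hb'

variable {ι κ : Type} [Fintype ι] [Fintype κ]

namespace IsPresentation

section Left

variable {p : ι → S} {C : κ → ι → R}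

theorem exists_sum_tmul (hp : IsPresentation p C) (x : BalancedTensor R M S) :
    ∃ n : ι → M, ∑ i, balancedTmul R (n i) (p i) = x := by
  induction x using balanced_induction with
  | h0 => exact ⟨0, by simp [zero_balancedTmul]⟩
  | ht m s =>
    obtain ⟨a, rfl⟩ := hp.exists_coeff s
    exact ⟨fun i => MulOpposite.op (a i) • m, by simp [balancedTmul_sum, smul_balancedTmul]⟩
  | ha x y hx hy =>
    obtain ⟨n, rfl⟩ := hx
    obtain ⟨n', rfl⟩ := hy
    exact ⟨n + n', by simp [add_balancedTmul, Finset.sum_add_distrib]⟩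

/-- A tensor `∑ n i ⊗ p i`, with `p` a generating family of a left module, vanishes exactly
if `n` is a combination of the relations between the `p i`. -/
theorem sum_tmul_eq_zero_iff (hp : IsPresentation p C) (n : ι → M) :
    ∑ i, balancedTmul R (n i) (p i) = 0 ↔
      ∃ w : κ → M, ∀ i, n i = ∑ r, MulOpposite.op (C r i) • w r := by
  classical
  constructor
  · intro h
    -- The map `M ⊗ S → (ι → M) / L` sends `m ⊗ ∑ a i • p i` to the class of `i ↦ m · a i`.
    let L : (κ → M) →+ (ι → M) := AddMonoidHom.mk'
      (fun w i => ∑ r, MulOpposite.op (C r i) • w r)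
      fun w w' => by ext i; simp [Finset.sum_add_distrib]
    let Q := (ι → M) ⧸ L.range
    let q : (ι → M) →+ Q := QuotientAddGroup.mk' L.range
    let θ : M →+ (ι → R) →+ (ι → M) := AddMonoidHom.mk'
      (fun m => AddMonoidHom.mk' (fun a i => MulOpposite.op (a i) • m)
        fun a a' => by ext i; simp [add_smul])
      fun m m' => by ext a i; simp
    have hθ : ∀ m a a', ∑ i, a i • p i = ∑ i, a' i • p i → q (θ m a) = q (θ m a') := by
      intro m a a' haa
      rw [← sub_eq_zero, ← map_sub, ← map_sub]
      refine (QuotientAddGroup.eq_zero_iff _).mpr ?_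
      obtain ⟨b, hb⟩ := (hp.sum_eq_zero_iff (a - a')).mp (by simp [sub_smul, haa])
      refine ⟨fun r => MulOpposite.op (b r) • m, ?_⟩
      ext i
      change ∑ r, MulOpposite.op (C r i) • MulOpposite.op (b r) • m =
        MulOpposite.op ((a - a') i) • m
      simp_rw [hb, smul_smul, ← MulOpposite.op_mul, Finset.op_sum, Finset.sum_smul]
    choose c hc using hp.exists_coeff
    let β : M →+ S →+ Q := AddMonoidHom.mk'
      (fun m => AddMonoidHom.mk' (fun s => q (θ m (c s))) fun s s' => by
        rw [← map_add, ← map_add]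
        refine hθ _ _ _ ?_
        simp only [Pi.add_apply, add_smul, Finset.sum_add_distrib, hc])
      fun m m' => by ext s; simp
    have hβ : ∀ (r : R) m s, β (MulOpposite.op r • m) s = β m (r • s) := by
      intro r m s
      have h1 : θ (MulOpposite.op r • m) (c s) = θ m (r • c s) := by
        ext i
        change MulOpposite.op (c s i) • MulOpposite.op r • m = MulOpposite.op (r * c s i) • m
        rw [smul_smul, ← MulOpposite.op_mul]
      change q (θ (MulOpposite.op r • m) (c s)) = q (θ m (c (r • s)))
      rw [h1]
      refine hθ _ _ _ ?_
      simp only [Pi.smul_apply, smul_assoc, ← Finset.smul_sum, hc]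
    have key : balancedLift β hβ (∑ i, balancedTmul R (n i) (p i)) = q n := by
      rw [map_sum]
      have h1 : ∀ i, balancedLift β hβ (balancedTmul R (n i) (p i)) = q (Pi.single i (n i)) := by
        intro i
        rw [balancedLift_tmul]
        have h2 : θ (n i) (Pi.single i 1) = Pi.single i (n i) := by
          ext j
          change MulOpposite.op ((Pi.single i 1 : ι → R) j) • n i = _
          by_cases hij : j = i
          · subst hij; simp
          · simp [hij]
        rw [← h2]
        refine hθ _ _ _ ?_
        rw [hc, Finset.sum_eq_single i] <;> simp +contextual
      rw [Finset.sum_congr rfl fun i _ => h1 i, ← map_sum, Finset.univ_sum_single]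
    rw [h, map_zero] at key
    obtain ⟨w, hw⟩ := (QuotientAddGroup.eq_zero_iff _).mp key.symm
    exact ⟨w, fun i => (congrFun hw i).symm⟩
  · rintro ⟨w, hw⟩
    simp_rw [hw, sum_balancedTmul, smul_balancedTmul]
    rw [Finset.sum_comm]
    simp_rw [← balancedTmul_sum, hp.rel, balancedTmul_zero, Finset.sum_const_zero]

end Left

section Right

variable {x : ι → M} {C : κ → ι → Rᵐᵒᵖ}

theorem exists_sum_tmul_right (hx : IsPresentation x C) (y : BalancedTensor R M S) :
    ∃ s : ι → S, ∑ i, balancedTmul R (x i) (s i) = y := by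
  induction y using balanced_induction with
  | h0 => exact ⟨0, by simp [balancedTmul_zero]⟩
  | ht m s =>
    obtain ⟨a, rfl⟩ := hx.exists_coeff m
    exact ⟨fun i => (a i).unop • s, by simp [sum_balancedTmul, op_smul_balancedTmul]⟩
  | ha x y hx hy =>
    obtain ⟨n, rfl⟩ := hx
    obtain ⟨n', rfl⟩ := hy
    exact ⟨n + n', by simp [balancedTmul_add, Finset.sum_add_distrib]⟩

/-- A tensor `∑ x i ⊗ s i`, with `x` a generating family of a right module, vanishes exactly
if `s` is a combination of the relations between the `x i`. -/
theorem sum_tmul_right_eq_zero_iff (hx : IsPresentation x C) (s : ι → S) :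
    ∑ i, balancedTmul R (x i) (s i) = 0 ↔
      ∃ σ : κ → S, ∀ i, s i = ∑ r, (C r i).unop • σ r := by
  classical
  constructor
  · intro h
    -- The map `M ⊗ S → (ι → S) / L` sends `(∑ x i · a i) ⊗ s` to the class of `i ↦ a i • s`.
    let L : (κ → S) →+ (ι → S) := AddMonoidHom.mk'
      (fun w i => ∑ r, (C r i).unop • w r)
      fun w w' => by ext i; simp [Finset.sum_add_distrib]
    let Q := (ι → S) ⧸ L.range
    let q : (ι → S) →+ Q := QuotientAddGroup.mk' L.range
    let θ : (ι → Rᵐᵒᵖ) →+ S →+ (ι → S) := AddMonoidHom.mk'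
      (fun a => AddMonoidHom.mk' (fun s i => (a i).unop • s)
        fun a a' => by ext i; simp)
      fun m m' => by ext a i; simp [add_smul]
    have hθ : ∀ s a a', ∑ i, a i • x i = ∑ i, a' i • x i → q (θ a s) = q (θ a' s) := by
      intro s a a' haa
      rw [← sub_eq_zero, ← map_sub, ← AddMonoidHom.sub_apply, ← map_sub]
      refine (QuotientAddGroup.eq_zero_iff _).mpr ?_
      obtain ⟨b, hb⟩ := (hx.sum_eq_zero_iff (a - a')).mp (by simp [sub_smul, haa])
      refine ⟨fun r => (b r).unop • s, ?_⟩
      ext i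
      change ∑ r, (C r i).unop • (b r).unop • s = ((a - a') i).unop • s
      simp_rw [hb, smul_smul, ← MulOpposite.unop_mul, Finset.unop_sum, Finset.sum_smul]
    choose c hc using hx.exists_coeff
    let β : M →+ S →+ Q := AddMonoidHom.mk'
      (fun m => AddMonoidHom.mk' (fun s => q (θ (c m) s)) fun s s' => by
        rw [← map_add, ← map_add])
      fun m m' => by
        ext s
        change q (θ (c (m + m')) s) = q (θ (c m) s) + q (θ (c m') s)
        rw [← map_add, ← AddMonoidHom.add_apply, ← map_add]
        refine hθ _ _ _ ?_
        simp only [Pi.add_apply, add_smul, Finset.sum_add_distrib, hc]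
    have hβ : ∀ (r : R) m s, β (MulOpposite.op r • m) s = β m (r • s) := by
      intro r m s
      have h1 : θ (c m) (r • s) = θ (MulOpposite.op r • c m) s := by
        ext i
        change (c m i).unop • r • s = (MulOpposite.op r * c m i).unop • s
        rw [smul_smul, MulOpposite.unop_mul, MulOpposite.unop_op]
      change q (θ (c (MulOpposite.op r • m)) s) = q (θ (c m) (r • s))
      rw [h1]
      refine hθ _ _ _ ?_
      simp only [Pi.smul_apply, smul_assoc, ← Finset.smul_sum, hc]
    have key : balancedLift β hβ (∑ i, balancedTmul R (x i) (s i)) = q s := by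
      rw [map_sum]
      have h1 : ∀ i, balancedLift β hβ (balancedTmul R (x i) (s i)) = q (Pi.single i (s i)) := by
        intro i
        rw [balancedLift_tmul]
        have h2 : θ (Pi.single i 1) (s i) = Pi.single i (s i) := by
          ext j
          change ((Pi.single i 1 : ι → Rᵐᵒᵖ) j).unop • s i = _
          by_cases hij : j = i
          · subst hij; simp
          · simp [hij]
        rw [← h2]
        refine hθ _ _ _ ?_
        rw [hc, Finset.sum_eq_single i] <;> simp +contextual
      rw [Finset.sum_congr rfl fun i _ => h1 i, ← map_sum, Finset.univ_sum_single]
    rw [h, map_zero] at key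
    obtain ⟨w, hw⟩ := (QuotientAddGroup.eq_zero_iff _).mp key.symm
    exact ⟨w, fun i => (congrFun hw i).symm⟩
  · rintro ⟨w, hw⟩
    simp_rw [hw, balancedTmul_sum, ← op_smul_balancedTmul]
    rw [Finset.sum_comm]
    simp_rw [← sum_balancedTmul, hx.rel, zero_balancedTmul, Finset.sum_const_zero]

end Right

end IsPresentation

end BalancedTensor

/-! ### Presentations of functors -/

section Additive

variable {C : Type u₁} [Category.{v₁} C] [Preadditive C] (F : C ⥤ AddCommGrpCat.{w}) [F.Additive]
  {X Y : C}

theorem map_add_apply (f g : X ⟶ Y) (x : F.obj X) : F.map (f + g) x = F.map f x + F.map g x := by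
  rw [F.map_add]; rfl

theorem map_sub_apply (f g : X ⟶ Y) (x : F.obj X) : F.map (f - g) x = F.map f x - F.map g x := by
  rw [F.map_sub]; rfl

theorem map_zero_apply (x : F.obj X) : F.map (0 : X ⟶ Y) x = 0 := by
  rw [F.map_zero]; rfl

end Additive

section Presented

variable {R : Type u} [Ring R]

/-- The element `x₀ ∈ F(P₂)` induces an exact sequence `Hom(P₁, -) → Hom(P₂, -) → F → 0`, whose
first map is the composition with `φ`. -/
structure IsPresentedBy (F : ModuleCat.{u} R ⥤ AddCommGrpCat.{w}) {P₁ P₂ : ModuleCat.{u} R}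
    (φ : P₂ ⟶ P₁) (x₀ : F.obj P₂) : Prop where
  gen : ∀ (S : ModuleCat.{u} R) (m : F.obj S), ∃ h : P₂ ⟶ S, F.map h x₀ = m
  rel : ∀ (S : ModuleCat.{u} R) (h : P₂ ⟶ S), F.map h x₀ = 0 ↔ ∃ g : P₁ ⟶ S, φ ≫ g = h

/-- `F` is the cokernel of a map between functors represented by finitely presented modules. -/
def IsCoherent (F : ModuleCat.{u} R ⥤ AddCommGrpCat.{w}) : Prop :=
  ∃ P₁ P₂ : ModuleCat.{u} R, Module.FinitePresentation R P₁ ∧ Module.FinitePresentation R P₂ ∧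
    ∃ (φ : P₂ ⟶ P₁) (x₀ : F.obj P₂), IsPresentedBy F φ x₀

namespace IsPresentedBy

variable {F : ModuleCat.{u} R ⥤ AddCommGrpCat.{w}} {P₁ P₂ : ModuleCat.{u} R}
    {φ : P₂ ⟶ P₁} {x₀ : F.obj P₂}

theorem hom_ext (hF : IsPresentedBy F φ x₀) {G : ModuleCat.{u} R ⥤ AddCommGrpCat.{w₂}}
    {a b : Hom F G} (h : a.app P₂ x₀ = b.app P₂ x₀) : a = b := by
  refine Hom.ext (funext fun S => AddMonoidHom.ext fun m => ?_)
  obtain ⟨f, rfl⟩ := hF.gen S m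
  rw [a.naturality, b.naturality, h]

theorem map_eq [F.Additive] (hF : IsPresentedBy F φ x₀) {G : ModuleCat.{u} R ⥤ AddCommGrpCat.{w₂}}
    [G.Additive] {y : G.obj P₂} (hy : G.map φ y = 0) {S : ModuleCat.{u} R} {f g : P₂ ⟶ S}
    (h : F.map f x₀ = F.map g x₀) : G.map f y = G.map g y := by
  obtain ⟨k, hk⟩ := (hF.rel S (f - g)).mp (by rw [map_sub_apply, h, sub_self])
  rw [← sub_eq_zero, ← map_sub_apply, ← hk, map_comp_apply, hy, map_zero]

/-- The Yoneda lemma for a presented functor: the morphisms `F → G` correspond to the elements of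
`G(P₂)` that die in `G(P₁)`. -/
theorem exists_hom [F.Additive] (hF : IsPresentedBy F φ x₀)
    {G : ModuleCat.{u} R ⥤ AddCommGrpCat.{w₂}} [G.Additive] (y : G.obj P₂) (hy : G.map φ y = 0) :
    ∃ a : Hom F G, a.app P₂ x₀ = y := by
  choose h hh using hF.gen
  refine ⟨⟨fun S => AddMonoidHom.mk' (fun m => G.map (h S m) y) fun m m' => ?_, fun f x => ?_⟩, ?_⟩
  · rw [← map_add_apply]
    refine hF.map_eq hy ?_
    rw [map_add_apply, hh, hh, hh]
  · change G.map _ y = G.map f (G.map _ y)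
    rw [← map_comp_apply]
    refine hF.map_eq hy ?_
    rw [map_comp_apply, hh, hh]
  · refine (hF.map_eq hy (g := 𝟙 _) ?_).trans (map_id_apply _ _)
    rw [hh, map_id_apply]

theorem map_self [F.Additive] (hF : IsPresentedBy F φ x₀) : F.map φ x₀ = 0 :=
  (hF.rel _ _).mpr ⟨𝟙 _, Category.comp_id _⟩

end IsPresentedBy

end Presented

/-! ### Morphisms between tensor functors -/

section TensorHom

variable {R : Type u} [Ring R]

theorem qcRight_map_apply {P : ModuleCat.{u} R} {N N' : ModuleCat.{u} Rᵐᵒᵖ} (f : N ⟶ N')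
    (x : BalancedTensor R N P) :
    (qcRight P).map f x = balancedMap R f.hom LinearMap.id x := rfl

instance (M : ModuleCat.{u} Rᵐᵒᵖ) : (qcLeft M).Additive where
  map_add {_ _ f g} := AddCommGrpCat.hom_ext (balanced_hom_ext R fun m s =>
    balancedTmul_add m (f s) (g s))

/-- The morphism `- ⊗ P → - ⊗ S` induced by `P → S`. -/
def tensorHom {P S : ModuleCat.{u} R} (h : P ⟶ S) : Hom (qcRight P) (qcRight S) where
  app N := balancedMap R (LinearMap.id : N →ₗ[Rᵐᵒᵖ] N) h.hom
  naturality {N N'} f x := DFunLike.congr_fun (balanced_hom_ext R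
    (f := (balancedMap R (LinearMap.id : N' →ₗ[Rᵐᵒᵖ] N') h.hom).comp
      (balancedMap R f.hom (LinearMap.id : P →ₗ[R] P)))
    (g := (balancedMap R f.hom (LinearMap.id : S →ₗ[R] S)).comp
      (balancedMap R (LinearMap.id : N →ₗ[Rᵐᵒᵖ] N) h.hom)) fun _ _ => rfl) x

/-- The multiplication `R ⊗_R S → S`. -/
def balancedLid (S : ModuleCat.{u} R) : BalancedTensor R R S →+ S :=
  balancedLift (AddMonoidHom.mk' (fun r => AddMonoidHom.mk' (fun s => r • s) (smul_add r))
    fun r r' => by ext s; exact add_smul r r' s) fun r r' s => mul_smul r' r s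

theorem balancedTmul_one_balancedLid (S : ModuleCat.{u} R) (x : BalancedTensor R R S) :
    balancedTmul R (1 : R) (balancedLid S x) = x := by
  induction x using balanced_induction with
  | h0 => rw [map_zero, balancedTmul_zero]
  | ht r s =>
    change balancedTmul R (1 : R) (r • s) = balancedTmul R r s
    rw [← smul_balancedTmul]
    change balancedTmul R (1 * r) s = _
    rw [one_mul]
  | ha x y hx hy => rw [map_add, balancedTmul_add, hx, hy]

theorem tensorHom_injective {P S : ModuleCat.{u} R} {h h' : P ⟶ S}
    (e : tensorHom h = tensorHom h') : h = h' := by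
  ext p
  have h1 : balancedTmul R (1 : R) (h p) = balancedTmul R (1 : R) (h' p) :=
    congrArg (fun a : Hom (qcRight P) (qcRight S) =>
      a.app (ModuleCat.of Rᵐᵒᵖ R) (balancedTmul R (1 : R) p)) e
  have h2 := congrArg (balancedLid S) h1
  change (1 : R) • h p = (1 : R) • h' p at h2
  rwa [one_smul, one_smul] at h2

/-- The right linear map `R → N` with value `n` at `1`. -/
def toRight (N : ModuleCat.{u} Rᵐᵒᵖ) (n : N) : ModuleCat.of Rᵐᵒᵖ R ⟶ N :=
  ModuleCat.ofHom
    { toFun := fun r => MulOpposite.op r • n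
      map_add' := fun r r' => by rw [MulOpposite.op_add, add_smul]
      map_smul' := fun r r' => by
        change MulOpposite.op (r' * r.unop) • n = r • MulOpposite.op r' • n
        rw [smul_smul, MulOpposite.op_mul, MulOpposite.op_unop] }

theorem toRight_one (N : ModuleCat.{u} Rᵐᵒᵖ) (n : N) : toRight N n (1 : R) = n :=
  one_smul Rᵐᵒᵖ n

/-- Every morphism `- ⊗ P → - ⊗ S` is induced by a linear map `P → S`, which is found by evaluation
at the right module `R`. -/
theorem exists_tensorHom {P S : ModuleCat.{u} R} (τ : Hom (qcRight P) (qcRight S)) :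
    ∃ h : P ⟶ S, tensorHom h = τ := by
  -- Naturality with respect to `R → N`, `1 ↦ n`, determines `τ (n ⊗ p)` from `τ (1 ⊗ p)`.
  have hnat : ∀ (N : ModuleCat.{u} Rᵐᵒᵖ) (n : N) (p : P),
      τ.app N (balancedTmul R n p) = balancedTmul R n
        (balancedLid S (τ.app (ModuleCat.of Rᵐᵒᵖ R) (balancedTmul R (1 : R) p))) := by
    intro N n p
    have h1 := τ.naturality (toRight N n) (balancedTmul R (1 : R) p)
    rw [qcRight_map_apply, balancedMap_tmul] at h1
    rw [← balancedTmul_one_balancedLid S (τ.app (ModuleCat.of Rᵐᵒᵖ R) (balancedTmul R (1 : R) p)),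
      qcRight_map_apply, balancedMap_tmul] at h1
    have h2 : (toRight N n).hom (1 : R) = n := toRight_one N n
    rw [h2] at h1
    exact h1
  let h : P →ₗ[R] S :=
    { toFun := fun p => balancedLid S (τ.app (ModuleCat.of Rᵐᵒᵖ R) (balancedTmul R (1 : R) p))
      map_add' := fun p p' => by
        rw [balancedTmul_add]
        erw [map_add, map_add]
      map_smul' := fun r p => by
        have h1 : balancedTmul R (1 : R) (r • p) = balancedTmul R r p := by
          rw [← smul_balancedTmul]
          change balancedTmul R (1 * r) p = _
          rw [one_mul]
        rw [h1, hnat]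
        rfl }
  refine ⟨ModuleCat.ofHom h, Hom.ext (funext fun N => balanced_hom_ext R fun n p => ?_)⟩
  exact (hnat N n p).symm

theorem tensorHom_add {P S : ModuleCat.{u} R} (f g : P ⟶ S) :
    tensorHom (f + g) = tensorHom f + tensorHom g :=
  Hom.ext (funext fun _ => balanced_hom_ext R fun n p => balancedTmul_add n (f p) (g p))

/-- The dual of `- ⊗ P` is represented by `P`. -/
def dualEquiv (P S : ModuleCat.{u} R) : (P ⟶ S) ≃+ (dualOfRight (qcRight P)).obj S :=
  AddEquiv.ofBijective (AddMonoidHom.mk' (M := P ⟶ S) (G := (dualOfRight (qcRight P)).obj S)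
    tensorHom tensorHom_add) ⟨fun _ _ e => tensorHom_injective e, exists_tensorHom⟩

theorem map_dualEquiv {P S S' : ModuleCat.{u} R} (g : S ⟶ S') (h : P ⟶ S) :
    (dualOfRight (qcRight P)).map g (dualEquiv P S h) = dualEquiv P S' (h ≫ g) :=
  Hom.ext (funext fun _ => balanced_hom_ext R fun _ _ => rfl)

theorem map_dualEquiv_symm {P S S' : ModuleCat.{u} R} (g : S ⟶ S')
    (τ : (dualOfRight (qcRight P)).obj S) :
    (dualEquiv P S').symm ((dualOfRight (qcRight P)).map g τ) = (dualEquiv P S).symm τ ≫ g := by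
  rw [AddEquiv.symm_apply_eq, ← map_dualEquiv, AddEquiv.apply_symm_apply]

/-- An exact sequence `P₁* → P₂* → F → 0` amounts to a presentation of `F` by the functors
represented by `P₁` and `P₂`. -/
theorem hasDualPresentation_iff {F : ModuleCat.{u} R ⥤ AddCommGrpCat.{u}} [F.Additive] :
    HasDualPresentation F ↔ IsCoherent F := by
  constructor
  · rintro ⟨P₁, P₂, h₁, h₂, f, g, hfg⟩
    obtain ⟨φ, hφ⟩ := (dualEquiv P₂ P₁).surjective (f.app P₁ (dualEquiv P₁ P₁ (𝟙 P₁)))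
    have hf : ∀ (S : ModuleCat.{u} R) (k : P₁ ⟶ S),
        f.app S (dualEquiv P₁ S k) = dualEquiv P₂ S (φ ≫ k) := by
      intro S k
      have := f.naturality k (dualEquiv P₁ P₁ (𝟙 P₁))
      rwa [map_dualEquiv, Category.id_comp, ← hφ, map_dualEquiv] at this
    have hg : ∀ (S : ModuleCat.{u} R) (k : P₂ ⟶ S),
        F.map k (g.app P₂ (dualEquiv P₂ P₂ (𝟙 P₂))) = g.app S (dualEquiv P₂ S k) := by
      intro S k
      rw [← g.naturality, map_dualEquiv, Category.id_comp]
    refine ⟨P₁, P₂, h₁, h₂, φ, g.app P₂ (dualEquiv P₂ P₂ (𝟙 P₂)), fun S m => ?_, fun S h => ?_⟩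
    · obtain ⟨τ, rfl⟩ := (hfg S).2 m
      obtain ⟨k, rfl⟩ := (dualEquiv P₂ S).surjective τ
      exact ⟨k, hg S k⟩
    · rw [hg, (hfg S).1]
      constructor
      · rintro ⟨τ, hτ⟩
        obtain ⟨k, rfl⟩ := (dualEquiv P₁ S).surjective τ
        exact ⟨k, (dualEquiv P₂ S).injective ((hf S k).symm.trans hτ)⟩
      · rintro ⟨k, rfl⟩
        exact ⟨dualEquiv P₁ S k, hf S k⟩
  · rintro ⟨P₁, P₂, h₁, h₂, φ, x₀, hF⟩
    let f : Hom (dualOfRight (qcRight P₁)) (dualOfRight (qcRight P₂)) :=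
      { app := fun S => ((dualEquiv P₂ S).toAddMonoidHom.comp
            (Preadditive.leftComp S φ)).comp (dualEquiv P₁ S).symm.toAddMonoidHom
        naturality := fun {S S'} k τ => by
          change dualEquiv P₂ S' (φ ≫ (dualEquiv P₁ S').symm _) =
            (dualOfRight (qcRight P₂)).map k (dualEquiv P₂ S (φ ≫ (dualEquiv P₁ S).symm τ))
          rw [map_dualEquiv, map_dualEquiv_symm, Category.assoc] }
    let g : Hom (dualOfRight (qcRight P₂)) F :=
      { app := fun S => (AddMonoidHom.mk' (fun k : P₂ ⟶ S => F.map k x₀)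
            fun k k' => map_add_apply F k k' x₀).comp (dualEquiv P₂ S).symm.toAddMonoidHom
        naturality := fun {S S'} k τ => by
          change F.map ((dualEquiv P₂ S').symm _) x₀ =
            F.map k (F.map ((dualEquiv P₂ S).symm τ) x₀)
          rw [map_dualEquiv_symm, map_comp_apply] }
    have hf : ∀ S (k : P₁ ⟶ S), f.app S (dualEquiv P₁ S k) = dualEquiv P₂ S (φ ≫ k) := fun S k =>
      congrArg (fun k => dualEquiv P₂ S (φ ≫ k)) ((dualEquiv P₁ S).symm_apply_apply k)
    have hg : ∀ S (k : P₂ ⟶ S), g.app S (dualEquiv P₂ S k) = F.map k x₀ := fun S k =>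
      congrArg (fun k => F.map k x₀) ((dualEquiv P₂ S).symm_apply_apply k)
    refine ⟨P₁, P₂, h₁, h₂, f, g, fun S => ⟨fun τ => ?_, fun m => ?_⟩⟩
    · obtain ⟨k, rfl⟩ := (dualEquiv P₂ S).surjective τ
      rw [hg, hF.rel]
      constructor
      · rintro ⟨l, rfl⟩
        exact ⟨dualEquiv P₁ S l, hf S l⟩
      · rintro ⟨τ, hτ⟩
        obtain ⟨l, rfl⟩ := (dualEquiv P₁ S).surjective τ
        exact ⟨l, (dualEquiv P₂ S).injective ((hf S l).symm.trans hτ)⟩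
    · obtain ⟨k, rfl⟩ := hF.gen S m
      exact ⟨dualEquiv P₂ S k, hg S k⟩

end TensorHom

/-! ### The transpose of a map between finitely presented modules -/

section Transpose

variable {R : Type u} [Ring R]

/-- The maps `φ : P₂ → P₁` and `ψ : N₀ → N'` are transposed to each other by the tensor
`z ∈ N₀ ⊗ P₂`: the sequences `Hom(P₁, S) → Hom(P₂, S) → N₀ ⊗ S → N' ⊗ S` and
`Hom(N', N) → Hom(N₀, N) → N ⊗ P₂ → N ⊗ P₁`, with middle maps given by `z`, are exact. -/
structure IsTransposePair {P₁ P₂ : ModuleCat.{u} R} {N₀ N' : ModuleCat.{u} Rᵐᵒᵖ} (φ : P₂ ⟶ P₁)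
    (ψ : N₀ ⟶ N') (z : BalancedTensor R N₀ P₂) : Prop where
  map_φ : balancedMap R (LinearMap.id : N₀ →ₗ[Rᵐᵒᵖ] N₀) φ.hom z = 0
  map_ψ : balancedMap R ψ.hom (LinearMap.id : P₂ →ₗ[R] P₂) z = 0
  factor_φ : ∀ (S : ModuleCat.{u} R) (h : P₂ ⟶ S),
    balancedMap R (LinearMap.id : N₀ →ₗ[Rᵐᵒᵖ] N₀) h.hom z = 0 → ∃ g : P₁ ⟶ S, φ ≫ g = h
  factor_ψ : ∀ (N : ModuleCat.{u} Rᵐᵒᵖ) (h : N₀ ⟶ N),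
    balancedMap R h.hom (LinearMap.id : P₂ →ₗ[R] P₂) z = 0 → ∃ g : N' ⟶ N, ψ ≫ g = h
  lift_left : ∀ (S : ModuleCat.{u} R) (t : BalancedTensor R N₀ S),
    balancedMap R ψ.hom (LinearMap.id : S →ₗ[R] S) t = 0 →
      ∃ h : P₂ ⟶ S, balancedMap R (LinearMap.id : N₀ →ₗ[Rᵐᵒᵖ] N₀) h.hom z = t
  lift_right : ∀ (N : ModuleCat.{u} Rᵐᵒᵖ) (t : BalancedTensor R N P₂),
    balancedMap R (LinearMap.id : N →ₗ[Rᵐᵒᵖ] N) φ.hom t = 0 →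
      ∃ h : N₀ ⟶ N, balancedMap R h.hom (LinearMap.id : P₂ →ₗ[R] P₂) z = t

open MulOpposite in
/-- Every map between finitely presented left modules has a transpose. If `P₂` has generators
`p i` with relations `C`, and `P₁` has generators `e j` with relations `B`, and
`φ (p i) = ∑ A i j • e j`, then `N₀` has generators `x i`, `y l` with relations
`∑ x i · A i j + ∑ y l · B l j`, and `N'` has generators `w r`, `y l` with relations
`∑ w r · (C A) r j + ∑ y l · B l j`; the map `ψ` sends `x i` to `∑ w r · C r i` and `y l` to `y l`,
and `z = ∑ x i ⊗ p i`. -/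
theorem exists_isTransposePair {P₁ P₂ : ModuleCat.{u} R} (h₁ : Module.FinitePresentation R P₁)
    (h₂ : Module.FinitePresentation R P₂) (φ : P₂ ⟶ P₁) :
    ∃ (N₀ N' : ModuleCat.{u} Rᵐᵒᵖ) (_ : Module.FinitePresentation Rᵐᵒᵖ N₀)
      (_ : Module.FinitePresentation Rᵐᵒᵖ N') (ψ : N₀ ⟶ N') (z : BalancedTensor R N₀ P₂),
      IsTransposePair φ ψ z := by
  obtain ⟨k, q, p, C, hp⟩ := exists_isPresentation (A := R) (P := P₂)
  obtain ⟨n, m, e, B, he⟩ := exists_isPresentation (A := R) (P := P₁)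
  choose A hA using fun i => he.exists_coeff (φ.hom (p i))
  let C₀ : Fin n → Fin k ⊕ Fin m → Rᵐᵒᵖ := fun j =>
    Sum.elim (fun i => op (A i j)) fun l => op (B l j)
  let C' : Fin n → Fin q ⊕ Fin m → Rᵐᵒᵖ := fun j =>
    Sum.elim (fun r => op (∑ i, C r i * A i j)) fun l => op (B l j)
  have hx := Presented.isPresentation C₀
  have hw := Presented.isPresentation C'
  set x := Presented.gen C₀ with hxdef
  set w := Presented.gen C' with hwdef
  have relx : ∀ j, ∑ i, op (A i j) • x (Sum.inl i) + ∑ l, op (B l j) • x (Sum.inr l) = 0 := by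
    intro j
    have := hx.rel j
    rwa [Fintype.sum_sum_type] at this
  have relw : ∀ j, ∑ r, op (∑ i, C r i * A i j) • w (Sum.inl r) +
      ∑ l, op (B l j) • w (Sum.inr l) = 0 := by
    intro j
    have := hw.rel j
    rwa [Fintype.sum_sum_type] at this
  -- the two ways to apply the product of the matrices `C` and `A`
  have swap : ∀ (N : Type u) [AddCommGroup N] [Module Rᵐᵒᵖ N] (v : Fin q → N) (j : Fin n),
      ∑ i, op (A i j) • ∑ r, op (C r i) • v r = ∑ r, op (∑ i, C r i * A i j) • v r := by
    intro N _ _ v j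
    simp_rw [Finset.smul_sum, Finset.op_sum, Finset.sum_smul, smul_smul, ← op_mul]
    exact Finset.sum_comm
  have swap' : ∀ (S : Type u) [AddCommGroup S] [Module R S] (σ : Fin n → S) (r : Fin q),
      ∑ i, C r i • ∑ j, A i j • σ j = ∑ j, (∑ i, C r i * A i j) • σ j := by
    intro S _ _ σ r
    simp_rw [Finset.smul_sum, Finset.sum_smul, smul_smul]
    exact Finset.sum_comm
  obtain ⟨ψ, hψ⟩ := hx.exists_desc
    (Sum.elim (fun i => ∑ r, op (C r i) • w (Sum.inl r)) fun l => w (Sum.inr l)) (by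
      intro j
      rw [Fintype.sum_sum_type]
      exact (congrArg (· + _) (swap _ _ j)).trans (relw j))
  have hφt : ∀ (N : Type u) [AddCommGroup N] [Module Rᵐᵒᵖ N] (v : Fin k → N),
      balancedMap R (LinearMap.id : N →ₗ[Rᵐᵒᵖ] N) φ.hom (∑ i, balancedTmul R (v i) (p i)) =
        ∑ j, balancedTmul R (∑ i, op (A i j) • v i) (e j) := by
    intro N _ _ v
    simp_rw [map_sum, balancedMap_tmul, ← hA, balancedTmul_sum, sum_balancedTmul, smul_balancedTmul]
    exact Finset.sum_comm
  have hhz : ∀ (S : Type u) [AddCommGroup S] [Module R S] (h : P₂ →ₗ[R] S),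
      balancedMap R (LinearMap.id : Presented C₀ →ₗ[Rᵐᵒᵖ] Presented C₀) h
        (∑ i, balancedTmul R (x (Sum.inl i)) (p i)) =
        ∑ a, balancedTmul R (x a) (Sum.elim (fun i => h (p i)) (fun _ => 0) a) := by
    intro S _ _ h
    simp [Fintype.sum_sum_type, balancedTmul_zero]
  have hzf : ∀ (N : Type u) [AddCommGroup N] [Module Rᵐᵒᵖ N] (f : Presented C₀ →ₗ[Rᵐᵒᵖ] N),
      balancedMap R f (LinearMap.id : P₂ →ₗ[R] P₂)
        (∑ i, balancedTmul R (x (Sum.inl i)) (p i)) =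
        ∑ i, balancedTmul R (f (x (Sum.inl i))) (p i) := by
    intro N _ _ f
    simp [map_sum]
  refine ⟨ModuleCat.of Rᵐᵒᵖ (Presented C₀), ModuleCat.of Rᵐᵒᵖ (Presented C'),
    Presented.finitePresentation C₀, Presented.finitePresentation C', ModuleCat.ofHom ψ,
    ∑ i, balancedTmul R (x (Sum.inl i)) (p i), ?_, ?_, ?_, ?_, ?_, ?_⟩
  · refine (hφt _ _).trans ((he.sum_tmul_eq_zero_iff _).mpr ⟨fun l => - x (Sum.inr l), fun j => ?_⟩)
    simp only [smul_neg, Finset.sum_neg_distrib]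
    exact eq_neg_of_add_eq_zero_left (relx j)
  · refine (hzf _ ψ).trans
      ((hp.sum_tmul_eq_zero_iff _).mpr ⟨fun r => w (Sum.inl r), fun i => hψ _⟩)
  · intro S h hh
    obtain ⟨σ, hσ⟩ := (hx.sum_tmul_right_eq_zero_iff _).mp ((hhz S h.hom).symm.trans hh)
    obtain ⟨g, hg⟩ := he.exists_desc σ fun l => (hσ (Sum.inr l)).symm
    refine ⟨ModuleCat.ofHom g, ModuleCat.hom_ext (hp.hom_ext fun i => ?_)⟩
    refine Eq.trans ?_ (hσ (Sum.inl i)).symm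
    change g (φ.hom (p i)) = _
    rw [← hA, map_sum]
    refine Finset.sum_congr rfl fun j _ => ?_
    rw [map_smul, hg]
    rfl
  · intro N h hh
    obtain ⟨v, hv⟩ := (hp.sum_tmul_eq_zero_iff _).mp ((hzf N h.hom).symm.trans hh)
    obtain ⟨g, hg⟩ := hw.exists_desc (Sum.elim v fun l => h.hom (x (Sum.inr l))) (by
      intro j
      rw [Fintype.sum_sum_type]
      refine (congrArg (· + _) ((swap _ _ j).symm.trans
        (Finset.sum_congr rfl fun i _ => congrArg _ (hv i).symm))).trans ?_
      have := congrArg h.hom (relx j)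
      simp only [map_add, map_sum, map_smul, map_zero] at this
      exact this)
    refine ⟨ModuleCat.ofHom g, ModuleCat.hom_ext (hx.hom_ext fun a => ?_)⟩
    change g (ψ (x a)) = h.hom (x a)
    rw [hψ]
    rcases a with i | l
    · rw [hv]
      simp only [Sum.elim_inl, map_sum, map_smul, hg]
    · exact hg _
  · intro S t ht
    obtain ⟨s, rfl⟩ := hx.exists_sum_tmul_right t
    have h1 : ∑ a, balancedTmul R (w a)
        (Sum.elim (fun r => ∑ i, C r i • s (Sum.inl i)) (fun l => s (Sum.inr l)) a) = 0 := by
      refine Eq.trans ?_ ht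
      change _ = balancedMap R ψ LinearMap.id _
      rw [map_sum, Fintype.sum_sum_type, Fintype.sum_sum_type]
      refine congrArg₂ (· + ·) ?_ (Finset.sum_congr rfl fun l _ => ?_)
      · simp only [balancedMap_tmul, hψ, Sum.elim_inl, sum_balancedTmul, balancedTmul_sum,
          smul_balancedTmul, LinearMap.id_apply]
        exact Finset.sum_comm
      · simp only [balancedMap_tmul, hψ, Sum.elim_inr, LinearMap.id_apply]
    obtain ⟨σ, hσ⟩ := (hw.sum_tmul_right_eq_zero_iff _).mp h1
    -- Subtracting `A σ` makes the first coordinates of `s` compatible with the relations `C`; it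
    -- changes `t` by the vanishing tensor whose coordinates are `(A σ, B σ)`.
    obtain ⟨h, hh⟩ := hp.exists_desc (fun i => s (Sum.inl i) - ∑ j, A i j • σ j) (by
      intro r
      simp_rw [smul_sub, Finset.sum_sub_distrib, swap' S σ r]
      exact sub_eq_zero.mpr (hσ (Sum.inl r)))
    refine ⟨ModuleCat.ofHom h, ?_⟩
    refine (hhz S h).trans ?_
    rw [← sub_eq_zero, ← Finset.sum_sub_distrib]
    have h2 : ∀ a, balancedTmul R (x a) (Sum.elim (fun i => h (p i)) (fun _ => 0) a) -
        balancedTmul R (x a) (s a) =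
          balancedTmul R (x a) (Sum.elim (fun i => h (p i)) (fun _ => 0) a - s a) := fun a =>
      (map_sub (tmulHom (x a)) _ _).symm
    simp_rw [h2]
    refine (hx.sum_tmul_right_eq_zero_iff _).mpr ⟨fun j => - σ j, ?_⟩
    rintro (i | l)
    · simp [hh, C₀]
    · simpa [C₀, C'] using hσ (Sum.inr l)
  · intro N t ht
    obtain ⟨v, rfl⟩ := hp.exists_sum_tmul t
    rw [hφt] at ht
    obtain ⟨y, hy⟩ := (he.sum_tmul_eq_zero_iff _).mp ht
    obtain ⟨h, hh⟩ := hx.exists_desc (Sum.elim v fun l => - y l) (by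
      intro j
      rw [Fintype.sum_sum_type]
      simp only [Sum.elim_inl, Sum.elim_inr, smul_neg, Finset.sum_neg_distrib]
      exact add_neg_eq_zero.mpr (hy j))
    refine ⟨ModuleCat.ofHom h, (hzf N h).trans ?_⟩
    simp only [hh, Sum.elim_inl]

end Transpose

/-! ### Coherent functors and their duals -/

section Coherent

variable {R : Type u} [Ring R]

/-- A natural transformation as a morphism of functors. -/
def Hom.ofNatTrans {C : Type u₁} [Category.{v₁} C] {F G : C ⥤ AddCommGrpCat.{w}} (α : F ⟶ G) :
    Hom F G where
  app S := (α.app S).hom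
  naturality f x := ConcreteCategory.congr_hom (α.naturality f) x

variable {F : ModuleCat.{u} R ⥤ AddCommGrpCat.{w}}
  {P₁ P₂ : ModuleCat.{u} R} {N₀ N' : ModuleCat.{u} Rᵐᵒᵖ} {φ : P₂ ⟶ P₁}
  {ψ : N₀ ⟶ N'} {z : BalancedTensor R N₀ P₂} {x₀ : F.obj P₂}

theorem dualOfLeft_map_app {N N' : ModuleCat.{u} Rᵐᵒᵖ} (f : N ⟶ N') (a : Hom F (qcLeft N))
    (S : ModuleCat.{u} R) (x : F.obj S) :
    Hom.app ((dualOfLeft F).map f a : Hom F (qcLeft N')) S x =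
      balancedMap R f.hom (LinearMap.id : S →ₗ[R] S) (a.app S x) := rfl

/-- The dual of a functor presented by `φ` is presented by the transpose of `φ`. -/
theorem IsPresentedBy.dual [F.Additive] (hF : IsPresentedBy F φ x₀) (hz : IsTransposePair φ ψ z)
    (a₀ : Hom F (qcLeft N₀)) (ha₀ : a₀.app P₂ x₀ = z) :
    IsPresentedBy (dualOfLeft F) ψ (a₀ : (dualOfLeft F).obj N₀) where
  gen N a := by
    change Hom F (qcLeft N) at a
    have h1 : balancedMap R (LinearMap.id : N →ₗ[Rᵐᵒᵖ] N) φ.hom (a.app P₂ x₀) = 0 := by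
      refine (a.naturality φ x₀).symm.trans ?_
      rw [hF.map_self, map_zero]
      rfl
    obtain ⟨h, hh⟩ := hz.lift_right N _ h1
    refine ⟨h, hF.hom_ext ?_⟩
    rw [dualOfLeft_map_app, ha₀, hh]
  rel N h := by
    constructor
    · intro h0
      refine hz.factor_ψ N h ?_
      rw [← ha₀, ← dualOfLeft_map_app, h0]
      rfl
    · rintro ⟨g, rfl⟩
      refine (map_comp_apply (dualOfLeft F) ψ g (a₀ : (dualOfLeft F).obj N₀)).trans ?_
      have h1 : (dualOfLeft F).map ψ (a₀ : (dualOfLeft F).obj N₀) = 0 := by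
        refine hF.hom_ext ?_
        rw [dualOfLeft_map_app, ha₀, hz.map_ψ]
        rfl
      rw [h1, map_zero]

/-- A functor presented by `φ` embeds in `N₀ ⊗ -` with image the kernel of `ψ ⊗ -`. -/
theorem IsPresentedBy.exact (hF : IsPresentedBy F φ x₀) (hz : IsTransposePair φ ψ z)
    (a₀ : Hom F (qcLeft N₀)) (ha₀ : a₀.app P₂ x₀ = z) (S : ModuleCat.{u} R) :
    Function.Injective (a₀.app S) ∧ ∀ t : BalancedTensor R N₀ S,
      balancedMap R ψ.hom (LinearMap.id : S →ₗ[R] S) t = 0 ↔ ∃ m, a₀.app S m = t := by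
  have key : ∀ h : P₂ ⟶ S, a₀.app S (F.map h x₀) =
      balancedMap R (LinearMap.id : N₀ →ₗ[Rᵐᵒᵖ] N₀) h.hom z := fun h => by
    rw [a₀.naturality, ha₀]
    rfl
  refine ⟨(injective_iff_map_eq_zero _).mpr fun m hm => ?_, fun t => ⟨fun ht => ?_, ?_⟩⟩
  · obtain ⟨h, rfl⟩ := hF.gen S m
    exact (hF.rel S h).mpr (hz.factor_φ S h ((key h).symm.trans hm))
  · obtain ⟨h, hh⟩ := hz.lift_left S t ht
    exact ⟨F.map h x₀, (key h).trans hh⟩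
  · rintro ⟨m, rfl⟩
    obtain ⟨h, rfl⟩ := hF.gen S m
    have h1 : balancedMap R ψ.hom (LinearMap.id : S →ₗ[R] S)
        (balancedMap R (LinearMap.id : N₀ →ₗ[Rᵐᵒᵖ] N₀) h.hom z) =
      balancedMap R (LinearMap.id : N' →ₗ[Rᵐᵒᵖ] N') h.hom
        (balancedMap R ψ.hom (LinearMap.id : P₂ →ₗ[R] P₂) z) :=
      DFunLike.congr_fun (balanced_hom_ext R
        (f := (balancedMap R ψ.hom (LinearMap.id : S →ₗ[R] S)).comp
          (balancedMap R (LinearMap.id : N₀ →ₗ[Rᵐᵒᵖ] N₀) h.hom))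
        (g := (balancedMap R (LinearMap.id : N' →ₗ[Rᵐᵒᵖ] N') h.hom).comp
          (balancedMap R ψ.hom (LinearMap.id : P₂ →ₗ[R] P₂))) fun _ _ => rfl) z
    refine (congrArg _ (key h)).trans (h1.trans ?_)
    rw [hz.map_ψ, map_zero]

theorem IsPresentedBy.exists_embedding [F.Additive] (hF : IsPresentedBy F φ x₀)
    (hz : IsTransposePair φ ψ z) :
    ∃ a₀ : Hom F (qcLeft N₀), a₀.app P₂ x₀ = z :=
  hF.exists_hom (G := qcLeft N₀) z hz.map_φ

/-- A coherent functor is the kernel of a map between tensor functors. -/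
theorem IsCoherent.hasTensorCopresentation {F : ModuleCat.{u} R ⥤ AddCommGrpCat.{u}} [F.Additive]
    (hF : IsCoherent F) : HasTensorCopresentation F := by
  obtain ⟨P₁, P₂, h₁, h₂, φ, x₀, hF⟩ := hF
  obtain ⟨N₀, N', h₀, h', ψ, z, hz⟩ := exists_isTransposePair h₁ h₂ φ
  obtain ⟨a₀, ha₀⟩ := hF.exists_embedding hz
  refine ⟨N₀, N', h₀, h', a₀, Hom.ofNatTrans ((tensor R).flip.map ψ), fun S => ?_⟩
  obtain ⟨hi, he⟩ := hF.exact hz a₀ ha₀ S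
  exact ⟨hi, he⟩

theorem IsCoherent.dual [F.Additive] (hF : IsCoherent F) : IsCoherent (dualOfLeft F) := by
  obtain ⟨P₁, P₂, h₁, h₂, φ, x₀, hF⟩ := hF
  obtain ⟨N₀, N', h₀, h', ψ, z, hz⟩ := exists_isTransposePair h₁ h₂ φ
  obtain ⟨a₀, ha₀⟩ := hF.exists_embedding hz
  exact ⟨N', N₀, h', h₀, ψ, _, hF.dual hz a₀ ha₀⟩

/-- Coherent functors are reflexive. -/
theorem IsCoherent.isReflexive [F.Additive] (hF : IsCoherent F) : IsReflexive F := by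
  obtain ⟨P₁, P₂, h₁, h₂, φ, x₀, hF⟩ := hF
  obtain ⟨N₀, N', h₀, h', ψ, z, hz⟩ := exists_isTransposePair h₁ h₂ φ
  obtain ⟨a₀, ha₀⟩ := hF.exists_embedding hz
  have hd := hF.dual hz a₀ ha₀
  intro S
  obtain ⟨hi, he⟩ := hF.exact hz a₀ ha₀ S
  constructor
  · intro m m' hmm
    exact hi (congrArg (fun τ : Hom (dualOfLeft F) (qcRight S) =>
      τ.app N₀ (a₀ : (dualOfLeft F).obj N₀)) hmm)
  · intro τ
    change Hom (dualOfLeft F) (qcRight S) at τ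
    have h1 : balancedMap R ψ.hom (LinearMap.id : S →ₗ[R] S)
        (τ.app N₀ (a₀ : (dualOfLeft F).obj N₀)) = 0 := by
      refine (τ.naturality ψ (a₀ : (dualOfLeft F).obj N₀)).symm.trans ?_
      rw [(hd.rel N' ψ).mpr ⟨𝟙 _, Category.comp_id _⟩, map_zero]
      rfl
    obtain ⟨m, hm⟩ := (he _).mp h1
    exact ⟨m, hd.hom_ext (G := qcRight S) hm⟩

/-- Coherent functors preserve direct limits. -/
theorem IsCoherent.preservesDirectLimits (hF : IsCoherent F) : PreservesDirectLimits F := by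
  obtain ⟨P₁, P₂, h₁, h₂, φ, x₀, hF⟩ := hF
  intro J _ _ _
  refine ⟨fun {D} => ⟨fun {c} hc => ?_⟩⟩
  have hc := IsDirectedColimit.of_isColimit_module hc
  refine IsDirectedColimit.nonempty_isColimit ⟨fun x => ?_, fun j y hy => ?_⟩
  · obtain ⟨h, rfl⟩ := hF.gen c.pt x
    obtain ⟨j, h', rfl⟩ := hc.exists_factor h₂ h
    exact ⟨j, F.map h' x₀, (map_comp_apply F _ _ _).symm⟩
  · obtain ⟨h, rfl⟩ := hF.gen (D.obj j) y
    obtain ⟨g, hg⟩ := (hF.rel c.pt (h ≫ c.ι.app j)).mp ((map_comp_apply F _ _ _).trans hy)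
    obtain ⟨i, g', rfl⟩ := hc.exists_factor h₁ g
    obtain ⟨l, hj, hi⟩ := exists_ge_ge j i
    obtain ⟨k, hlk, hk⟩ := hc.exists_zero h₂
      (h ≫ D.map (homOfLE hj) - φ ≫ g' ≫ D.map (homOfLE hi)) (by
        rw [Preadditive.sub_comp, Category.assoc, Category.assoc, Category.assoc, c.w, c.w, hg,
          sub_self])
    refine ⟨k, hj.trans hlk, ?_⟩
    refine (map_comp_apply F _ _ _).symm.trans ((hF.rel _ _).mpr
      ⟨g' ≫ D.map (homOfLE hi) ≫ D.map (homOfLE hlk), ?_⟩)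
    rw [Preadditive.sub_comp, sub_eq_zero, Category.assoc, Category.assoc, Category.assoc,
      ← D.map_comp] at hk
    exact hk.symm

end Coherent

/-! ### Functors that preserve direct products -/

section Products

variable {R : Type u} [Ring R]

/-- Tensoring with a finitely presented module preserves direct products. -/
theorem productsBijective_qcLeft {Q : ModuleCat.{u} Rᵐᵒᵖ}
    (hQ : Module.FinitePresentation Rᵐᵒᵖ Q) : ProductsBijective (qcLeft Q) := by
  obtain ⟨n, m, x, C, hx⟩ := exists_isPresentation (A := Rᵐᵒᵖ) (P := Q)
  intro I S
  have hproj : ∀ (s : Fin n → ∀ a, S a) (a : I),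
      (qcLeft Q).map (prodProj S a) (∑ i, balancedTmul R (x i) (s i)) =
        ∑ i, balancedTmul R (x i) (s i a) := fun s a =>
    map_sum (balancedMap R (LinearMap.id : Q →ₗ[Rᵐᵒᵖ] Q) (prodProj S a).hom) _ _
  constructor
  · refine (injective_iff_map_eq_zero (AddMonoidHom.mk' _ fun t t' => ?_)).mpr fun t ht => ?_
    · funext a
      exact map_add ((qcLeft Q).map (prodProj S a)).hom t t'
    · obtain ⟨s, rfl⟩ := hx.exists_sum_tmul_right (S := ∀ a, S a) t
      have h1 : ∀ a, ∃ σ : Fin m → S a, ∀ i, s i a = ∑ r, (C r i).unop • σ r := fun a =>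
        (hx.sum_tmul_right_eq_zero_iff _).mp ((hproj s a).symm.trans (congrFun ht a))
      choose σ hσ using h1
      refine (hx.sum_tmul_right_eq_zero_iff s).mpr ⟨fun r a => σ a r, fun i => ?_⟩
      funext a
      rw [hσ, Finset.sum_apply]
      rfl
  · intro t
    choose s hs using fun a => hx.exists_sum_tmul_right (S := S a) (t a)
    refine ⟨∑ i, balancedTmul R (x i) (fun a => s a i), ?_⟩
    funext a
    exact (hproj (fun i a => s a i) a).trans (hs a)

/-- The kernel of a map between tensor products with finitely presented modules preserves
direct products. -/
theorem HasTensorCopresentation.productsBijective {F : ModuleCat.{u} R ⥤ AddCommGrpCat.{u}}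
    (hF : HasTensorCopresentation F) : ProductsBijective F := by
  obtain ⟨Q₁, Q₂, h₁, h₂, f, g, hfg⟩ := hF
  intro I S
  constructor
  · intro m m' h
    refine (hfg _).1 ((productsBijective_qcLeft h₁ I S).1 (funext fun a => ?_))
    have h' := congrArg (f.app (S a)) (congrFun h a)
    exact (f.naturality _ _).symm.trans (h'.trans (f.naturality _ _))
  · intro m
    obtain ⟨t, ht⟩ := (productsBijective_qcLeft h₁ I S).2 fun a => f.app (S a) (m a)
    have hgt : g.app _ t = 0 := (productsBijective_qcLeft h₂ I S).1 (funext fun a => by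
      refine (g.naturality _ _).symm.trans ?_
      refine ((congrArg _ (congrFun ht a)).trans ((hfg (S a)).2.apply_apply_eq_zero _)).trans ?_
      exact (map_zero ((qcLeft Q₂).map (prodProj S a)).hom).symm)
    obtain ⟨m', rfl⟩ := ((hfg _).2 t).mp hgt
    refine ⟨m', funext fun a => (hfg (S a)).1 ?_⟩
    exact (f.naturality _ _).trans (congrFun ht a)

/-- If `F` preserves direct products and its elements come from finitely presented modules, then
`F` is generated by one element of its value at a finitely presented module: the family of all
elements at finitely presented modules is an element of a product, and comes
from a finitely presented module. -/
theorem ProductsBijective.exists_generator {F : ModuleCat.{u} R ⥤ AddCommGrpCat.{u}}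
    (hF : ProductsBijective F)
    (hl : ∀ (S : ModuleCat.{u} R) (x : F.obj S), ∃ (P : ModuleCat.{u} R)
      (_ : Module.FinitePresentation R P) (f : P ⟶ S) (y : F.obj P), F.map f y = x) :
    ∃ (P : ModuleCat.{u} R) (_ : Module.FinitePresentation R P) (x₀ : F.obj P),
      ∀ (S : ModuleCat.{u} R) (m : F.obj S), ∃ h : P ⟶ S, F.map h x₀ = m := by
  obtain ⟨x, hx⟩ := (hF (Σ i : FPIndex R, F.obj (fpMod i)) fun a => fpMod a.1).2 fun a => a.2
  obtain ⟨P, hP, f, x₀, hf⟩ := hl _ x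
  refine ⟨P, hP, x₀, fun S m => ?_⟩
  obtain ⟨P', hP', f', y, rfl⟩ := hl S m
  obtain ⟨i, ⟨e⟩⟩ := exists_iso_fpMod hP'
  have h1 := congrFun hx ⟨i, F.map e.hom y⟩
  refine ⟨f ≫ prodProj _ ⟨i, F.map e.hom y⟩ ≫ e.inv ≫ f', ?_⟩
  rw [map_comp_apply, hf, map_comp_apply]
  refine (congrArg (F.map (e.inv ≫ f')) h1).trans ?_
  rw [← map_comp_apply, e.hom_inv_id_assoc]

/-- The maps `h : P → S` with `F(h)(x₀) = 0`. -/
def relSubgroup (F : ModuleCat.{u} R ⥤ AddCommGrpCat.{w}) [F.Additive] {P : ModuleCat.{u} R}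
    (x₀ : F.obj P) (S : ModuleCat.{u} R) : AddSubgroup (P ⟶ S) :=
  (AddMonoidHom.mk' (fun h : P ⟶ S => F.map h x₀) fun h h' => map_add_apply F h h' x₀).ker

theorem mem_relSubgroup {F : ModuleCat.{u} R ⥤ AddCommGrpCat.{w}} [F.Additive]
    {P : ModuleCat.{u} R} {x₀ : F.obj P} {S : ModuleCat.{u} R} {h : P ⟶ S} :
    h ∈ relSubgroup F x₀ S ↔ F.map h x₀ = 0 :=
  Iff.rfl

/-- The kernel of the morphism `Hom(P, -) → F` given by an element of `F(P)`. -/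
def relFunctor (F : ModuleCat.{u} R ⥤ AddCommGrpCat.{w}) [F.Additive] {P : ModuleCat.{u} R}
    (x₀ : F.obj P) : ModuleCat.{u} R ⥤ AddCommGrpCat.{u} where
  obj S := AddCommGrpCat.of (relSubgroup F x₀ S)
  map {S S'} f := AddCommGrpCat.ofHom (AddMonoidHom.mk'
    (fun h => ⟨h.1 ≫ f, by
      rw [mem_relSubgroup, map_comp_apply, mem_relSubgroup.mp h.2, map_zero]⟩)
    fun h h' => Subtype.ext (Preadditive.add_comp _ _ _ h.1 h'.1 f))
  map_id S := AddCommGrpCat.hom_ext (AddMonoidHom.ext fun h => Subtype.ext (Category.comp_id h.1))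
  map_comp f g := AddCommGrpCat.hom_ext (AddMonoidHom.ext fun h =>
    Subtype.ext (Category.assoc h.1 f g).symm)

/-- A functor that preserves direct limits and direct products is coherent. -/
theorem ProductsBijective.isCoherent {F : ModuleCat.{u} R ⥤ AddCommGrpCat.{u}} [F.Additive]
    (hF : ProductsBijective F) (hd : DeterminedByFP F) : IsCoherent F := by
  obtain ⟨P₂, h₂, x₀, hx₀⟩ := hF.exists_generator hd.lift
  have hK : ProductsBijective (relFunctor F x₀) := by
    intro I S
    constructor
    · intro h h' e
      refine Subtype.ext ((ModuleCat.productConeIsLimit.{u, u} S).hom_ext fun a => ?_)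
      exact congrArg Subtype.val (congrFun e a.as)
    · intro h
      let l : P₂ ⟶ ModuleCat.of R (∀ a, S a) := ModuleCat.ofHom (LinearMap.pi fun a => (h a).1.hom)
      have hl : F.map l x₀ = 0 := (hF I S).1 (funext fun a => by
        refine (map_comp_apply F l (prodProj S a) x₀).symm.trans ?_
        exact (mem_relSubgroup.mp (h a).2).trans (map_zero (F.map (prodProj S a)).hom).symm)
      exact ⟨⟨l, hl⟩, rfl⟩
  obtain ⟨P₁, h₁, y, hy⟩ := hK.exists_generator fun S x => by
    obtain ⟨P', hP', g, h, hgh, hg⟩ := hd.zero P₂ S h₂ x.1 x₀ (mem_relSubgroup.mp x.2)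
    exact ⟨P', hP', h, ⟨g, hg⟩, Subtype.ext hgh⟩
  refine ⟨P₁, P₂, h₁, h₂, y.1, x₀, hx₀, fun S h => ⟨fun h0 => ?_, ?_⟩⟩
  · obtain ⟨g, hg⟩ := hy S ⟨h, h0⟩
    exact ⟨g, congrArg Subtype.val hg⟩
  · rintro ⟨g, rfl⟩
    rw [map_comp_apply, mem_relSubgroup.mp y.2, map_zero]

end Products

/-! ### Reflexive functors whose dual preserves direct limits -/

section Reflexive

variable {R : Type u} [Ring R]

/-- A family of homomorphisms that is natural on finitely presented modules extends to all
modules. -/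
theorem DeterminedByFP.exists_extension {G : ModuleCat.{u} R ⥤ AddCommGrpCat.{w₁}}
    (hG : DeterminedByFP G) (H : ModuleCat.{u} R ⥤ AddCommGrpCat.{w₂})
    (t : ∀ P : ModuleCat.{u} R, Module.FinitePresentation R P → (G.obj P →+ H.obj P))
    (ht : ∀ (P P' : ModuleCat.{u} R) (hP : Module.FinitePresentation R P)
      (hP' : Module.FinitePresentation R P') (f : P ⟶ P') (x : G.obj P),
      t P' hP' (G.map f x) = H.map f (t P hP x)) :
    ∃ τ : Hom G H, ∀ P hP, τ.app P = t P hP := by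
  have hpair : ∀ {N P P' : ModuleCat.{u} R} (hP : Module.FinitePresentation R P)
      (hP' : Module.FinitePresentation R P') (f : P ⟶ N) (f' : P' ⟶ N),
      ∃ (Q : ModuleCat.{u} R) (_ : Module.FinitePresentation R Q) (i : P ⟶ Q) (i' : P' ⟶ Q)
        (c : Q ⟶ N), i ≫ c = f ∧ i' ≫ c = f' := by
    intro N P P' hP hP' f f'
    refine ⟨ModuleCat.of R (P × P'), inferInstance, ModuleCat.ofHom (LinearMap.inl R P P'),
      ModuleCat.ofHom (LinearMap.inr R P P'), ModuleCat.ofHom (LinearMap.coprod f.hom f'.hom),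
      ModuleCat.hom_ext ?_, ModuleCat.hom_ext ?_⟩
    · exact LinearMap.coprod_inl _ _
    · exact LinearMap.coprod_inr _ _
  -- The value at `G(f)(y)` is independent of the choice of `f` and `y`: two choices become equal
  -- over the direct sum of the modules, up to an element that dies at some `Q'`.
  have key : ∀ {N P P' : ModuleCat.{u} R} (hP : Module.FinitePresentation R P)
      (hP' : Module.FinitePresentation R P') (f : P ⟶ N) (f' : P' ⟶ N) (y : G.obj P)
      (y' : G.obj P'), G.map f y = G.map f' y' → H.map f (t P hP y) = H.map f' (t P' hP' y') := by
    intro N P P' hP hP' f f' y y' e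
    obtain ⟨Q, hQ, i, i', c, rfl, rfl⟩ := hpair hP hP' f f'
    rw [map_comp_apply, map_comp_apply] at e
    obtain ⟨Q', hQ', g, h, rfl, hg⟩ := hG.zero Q N hQ c (G.map i y - G.map i' y') (by
      rw [map_sub, e, sub_self])
    rw [map_sub, sub_eq_zero] at hg
    have := congrArg (t Q' hQ') hg
    rw [ht _ _ hQ, ht _ _ hP, ht _ _ hQ, ht _ _ hP'] at this
    simp only [map_comp_apply, this]
  choose P hP f y hy using hG.lift
  refine ⟨⟨fun N => AddMonoidHom.mk' (fun x => H.map (f N x) (t _ (hP N x) (y N x)))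
    fun x x' => ?_, fun {N N'} k x => ?_⟩, fun N hN => AddMonoidHom.ext fun x => ?_⟩
  · obtain ⟨Q, hQ, i, i', c, hi, hi'⟩ := hpair (hP N x) (hP N x') (f N x) (f N x')
    rw [key (hP N (x + x')) hQ (f N (x + x')) c _ (G.map i (y N x) + G.map i' (y N x')), map_add,
      map_add, ht _ _ (hP N x), ht _ _ (hP N x'), ← map_comp_apply, ← map_comp_apply, hi, hi']
    rw [map_add, ← map_comp_apply, ← map_comp_apply, hi, hi', hy, hy, hy]
  · change H.map _ _ = H.map k (H.map _ _)
    rw [← map_comp_apply]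
    refine key _ _ _ _ _ _ ?_
    rw [map_comp_apply, hy, hy]
  · refine (key (hP N x) hN (f N x) (𝟙 N) (y N x) x ?_).trans (map_id_apply _ _)
    rw [hy, map_id_apply]

variable {F : ModuleCat.{u} R ⥤ AddCommGrpCat.{u}}

/-- Elements of a reflexive functor `F` are separated by the morphisms `F → N ⊗ -` with `N` finitely
presented, provided that the dual of `F` preserves direct limits. -/
theorem IsReflexive.eq_of_forall (hF : IsReflexive F) (hd : DeterminedByFP (dualOfLeft F))
    {S : ModuleCat.{u} R} {m m' : F.obj S}
    (h : ∀ N : ModuleCat.{u} Rᵐᵒᵖ, Module.FinitePresentation Rᵐᵒᵖ N →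
      ∀ a : Hom F (qcLeft N), a.app S m = a.app S m') : m = m' := by
  refine (hF S).1 (Hom.ext (funext fun N => AddMonoidHom.ext fun a => ?_))
  change Hom F (qcLeft N) at a
  change a.app S m = a.app S m'
  obtain ⟨N', hN', f, b, hb⟩ := hd.lift N a
  change Hom F (qcLeft N') at b
  rw [← hb]
  exact congrArg (balancedMap R f.hom (LinearMap.id : S →ₗ[R] S)) (h N' hN' b)

/-- A reflexive functor whose dual preserves direct limits preserves direct products, because
tensoring with finitely presented modules does. -/
theorem IsReflexive.productsBijective (hF : IsReflexive F) (hd : DeterminedByFP (dualOfLeft F)) :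
    ProductsBijective F := by
  intro I S
  constructor
  · intro m m' h
    refine hF.eq_of_forall hd fun N hN a => ?_
    refine (productsBijective_qcLeft hN I S).1 (funext fun i => ?_)
    refine (a.naturality _ _).symm.trans (Eq.trans ?_ (a.naturality _ _))
    exact congrArg (a.app (S i)) (congrFun h i)
  · intro m
    choose r hr using fun (N : ModuleCat.{u} Rᵐᵒᵖ) (hN : Module.FinitePresentation Rᵐᵒᵖ N) x =>
      (productsBijective_qcLeft hN I S).2 x
    have hinj := fun (N : ModuleCat.{u} Rᵐᵒᵖ) (hN : Module.FinitePresentation Rᵐᵒᵖ N) =>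
      (productsBijective_qcLeft hN I S).1
    have hr' : ∀ N hN x i, (qcLeft N).map (prodProj S i) (r N hN x) = x i :=
      fun N hN x i => congrFun (hr N hN x) i
    -- The family `N ↦ (a ↦ (a (m i))_i)`, defined for finitely presented `N` through the
    -- isomorphism `N ⊗ ∏ S_i ≃ ∏ N ⊗ S_i`.
    obtain ⟨τ, hτ⟩ := hd.exists_extension (qcRight (ModuleCat.of R (∀ i, S i)))
      (fun N hN => AddMonoidHom.mk'
        (fun a : Hom F (qcLeft N) => r N hN fun i => a.app (S i) (m i))
        fun a b => hinj N hN (funext fun i => by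
          refine (hr' N hN _ i).trans ?_
          refine Eq.trans ?_ (map_add ((qcLeft N).map (prodProj S i)).hom _ _).symm
          exact (congrArg₂ (· + ·) (hr' N hN (fun i => a.app (S i) (m i)) i)
            (hr' N hN (fun i => b.app (S i) (m i)) i)).symm))
      (fun N N' hN hN' f a => hinj N' hN' (funext fun i => by
        change Hom F (qcLeft N) at a
        refine (hr' N' hN' _ i).trans ?_
        refine (congrArg (balancedMap R f.hom (LinearMap.id : S i →ₗ[R] S i))
          (hr' N hN (fun i => a.app (S i) (m i)) i).symm).trans ?_
        exact ConcreteCategory.congr_hom (((tensor R).map (prodProj S i)).naturality f).symm _))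
    obtain ⟨m₀, hm₀⟩ := (hF _).2 τ
    refine ⟨m₀, funext fun i => hF.eq_of_forall hd fun N hN a => ?_⟩
    refine (a.naturality _ _).trans ?_
    have h1 : a.app _ m₀ = τ.app N a := congrArg (fun σ : Hom (dualOfLeft F) (qcRight _) =>
      σ.app N (a : (dualOfLeft F).obj N)) hm₀
    rw [h1, hτ N hN]
    exact hr' N hN _ i

end Reflexive

/-! ### Morphisms into direct limits of functors -/

section HomCommutes

variable {R : Type u} [Ring R]

/-- A morphism of functors as a natural transformation. -/
def Hom.toNatTrans {C : Type u₁} [Category.{v₁} C] {F G : C ⥤ AddCommGrpCat.{w}} (a : Hom F G) :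
    F ⟶ G where
  app S := AddCommGrpCat.ofHom (a.app S)
  naturality _ _ f := AddCommGrpCat.hom_ext (AddMonoidHom.ext fun x => a.naturality f x)

theorem isDirectedColimit_evaluation {J : Type u} [Preorder J] [IsDirectedOrder J] [Nonempty J]
    {M : J ⥤ ModuleCat.{u} R ⥤ AddCommGrpCat.{u}} {c : Cocone M} (hc : IsColimit c)
    (P : ModuleCat.{u} R) :
    IsDirectedColimit (((evaluation (ModuleCat.{u} R) AddCommGrpCat.{u}).obj P).mapCocone c) :=
  .of_isColimit.{u, u} (isColimitOfPreserves _ hc)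

/-- Morphisms out of a coherent functor commute with direct limits: they are elements of the
value at a finitely presented module that die at another one. -/
theorem IsCoherent.homCommutes {F : ModuleCat.{u} R ⥤ AddCommGrpCat.{u}} [F.Additive]
    (hF : IsCoherent F) : HomCommutesWithDirectLimits F := by
  obtain ⟨P₁, P₂, -, -, φ, x₀, hF⟩ := hF
  intro J _ _ _ M hM
  refine ⟨fun {c} hc => IsDirectedColimit.nonempty_isColimit ⟨fun α => ?_, fun j α hα => ?_⟩⟩
  · change F ⟶ c.pt at α
    obtain ⟨j, y, hy⟩ := (isDirectedColimit_evaluation hc P₂).surj (α.app P₂ x₀)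
    change (c.ι.app j).app P₂ y = α.app P₂ x₀ at hy
    have h0 : (c.ι.app j).app P₁ ((M.obj j).map φ y) = 0 := by
      refine ((Hom.ofNatTrans (c.ι.app j)).naturality φ y).trans ?_
      refine (congrArg (c.pt.map φ) hy).trans ?_
      refine ((Hom.ofNatTrans α).naturality φ x₀).symm.trans ?_
      rw [hF.map_self, map_zero]
    obtain ⟨k, hjk, hk⟩ := (isDirectedColimit_evaluation hc P₁).zero j ((M.obj j).map φ y) h0
    have h1 : (M.obj k).map φ ((M.map (homOfLE hjk)).app P₂ y) = 0 :=
      ((Hom.ofNatTrans (M.map (homOfLE hjk))).naturality φ y).symm.trans hk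
    have := hM k
    obtain ⟨a, ha⟩ := hF.exists_hom (G := M.obj k) _ h1
    refine ⟨k, a.toNatTrans, ?_⟩
    have h2 : Hom.ofNatTrans (a.toNatTrans ≫ c.ι.app k) = Hom.ofNatTrans α := by
      refine hF.hom_ext ?_
      change (c.ι.app k).app P₂ (a.app P₂ x₀) = α.app P₂ x₀
      rw [ha, ← hy, ← c.w (homOfLE hjk)]
      rfl
    exact NatTrans.ext (funext fun S => AddCommGrpCat.hom_ext (congrFun (congrArg Hom.app h2) S))
  · change F ⟶ M.obj j at α
    have h0 : (c.ι.app j).app P₂ (α.app P₂ x₀) = 0 :=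
      congrArg (fun β : F ⟶ c.pt => β.app P₂ x₀) hα
    obtain ⟨k, hjk, hk⟩ := (isDirectedColimit_evaluation hc P₂).zero j (α.app P₂ x₀) h0
    refine ⟨k, hjk, ?_⟩
    have h2 : Hom.ofNatTrans (α ≫ M.map (homOfLE hjk)) = 0 := hF.hom_ext hk
    exact NatTrans.ext (funext fun S => AddCommGrpCat.hom_ext (congrFun (congrArg Hom.app h2) S))

end HomCommutes

/-! ### Quotients by subfunctors generated by elements -/

section Span

variable {R : Type u} [Ring R] (E : ModuleCat.{u} R ⥤ AddCommGrpCat.{u}) {T : Type u}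
  {Q : T → ModuleCat.{u} R} (x : ∀ t, E.obj (Q t))

/-- The value at `S` of the subfunctor of `E` generated by the elements `x t ∈ E(Q t)`
with `t ∈ X`. -/
def spanSub (X : Set T) (S : ModuleCat.{u} R) : AddSubgroup (E.obj S) :=
  AddSubgroup.closure {y | ∃ t ∈ X, ∃ f : Q t ⟶ S, E.map f (x t) = y}

variable {E x}

theorem map_mem_spanSub {X : Set T} {S S' : ModuleCat.{u} R} (f : S ⟶ S') {y : E.obj S}
    (hy : y ∈ spanSub E x X S) : E.map f y ∈ spanSub E x X S' := by
  have : spanSub E x X S ≤ (spanSub E x X S').comap (E.map f).hom := by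
    refine (AddSubgroup.closure_le _).mpr ?_
    rintro _ ⟨t, ht, g, rfl⟩
    exact AddSubgroup.subset_closure ⟨t, ht, g ≫ f, map_comp_apply _ _ _ _⟩
  exact this hy

theorem spanSub_mono {X Y : Set T} (h : X ⊆ Y) (S : ModuleCat.{u} R) :
    spanSub E x X S ≤ spanSub E x Y S :=
  AddSubgroup.closure_mono fun _ ⟨t, ht, hf⟩ => ⟨t, h ht, hf⟩

theorem exists_finset_mem_spanSub {S : ModuleCat.{u} R} {y : E.obj S}
    (hy : y ∈ spanSub E x Set.univ S) : ∃ X : Finset T, y ∈ spanSub E x X S := by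
  classical
  induction hy using AddSubgroup.closure_induction with
  | mem y hy =>
    obtain ⟨t, -, f, rfl⟩ := hy
    exact ⟨{t}, AddSubgroup.subset_closure ⟨t, by simp, f, rfl⟩⟩
  | zero => exact ⟨∅, zero_mem _⟩
  | add y z _ _ hy hz =>
    obtain ⟨X, hX⟩ := hy
    obtain ⟨Y, hY⟩ := hz
    exact ⟨X ∪ Y, add_mem (spanSub_mono (Finset.coe_subset.mpr Finset.subset_union_left) _ hX)
      (spanSub_mono (Finset.coe_subset.mpr Finset.subset_union_right) _ hY)⟩
  | neg y _ hy =>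
    obtain ⟨X, hX⟩ := hy
    exact ⟨X, neg_mem hX⟩

/-- The elements at finitely many finitely presented modules generate the same subfunctor as
one element at a finitely presented module, namely at the direct sum. -/
theorem exists_generator_spanSub [E.Additive] (hQ : ∀ t, Module.FinitePresentation R (Q t))
    (X : Finset T) : ∃ (P : ModuleCat.{u} R) (_ : Module.FinitePresentation R P) (x₀ : E.obj P),
      x₀ ∈ spanSub E x X P ∧ ∀ S, ∀ y ∈ spanSub E x X S, ∃ h : P ⟶ S, E.map h x₀ = y := by
  classical
  induction X using Finset.induction with
  | empty =>
    refine ⟨ModuleCat.of R PUnit, inferInstance, 0, zero_mem _, fun S y hy => ⟨0, ?_⟩⟩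
    have : y = 0 := by simpa [spanSub] using hy
    rw [this, map_zero]
  | insert t X _ ih =>
    obtain ⟨P, hP, x₀, hx₀, hgen⟩ := ih
    have := hQ t
    let i : P ⟶ ModuleCat.of R (P × Q t) := ModuleCat.ofHom (LinearMap.inl R P (Q t))
    let i' : Q t ⟶ ModuleCat.of R (P × Q t) := ModuleCat.ofHom (LinearMap.inr R P (Q t))
    have hc : ∀ {S : ModuleCat.{u} R} (f : P ⟶ S) (g : Q t ⟶ S),
        ∃ h : ModuleCat.of R (P × Q t) ⟶ S, i ≫ h = f ∧ i' ≫ h = g := fun f g =>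
      ⟨ModuleCat.ofHom (LinearMap.coprod f.hom g.hom),
        ModuleCat.hom_ext (LinearMap.coprod_inl _ _), ModuleCat.hom_ext (LinearMap.coprod_inr _ _)⟩
    refine ⟨ModuleCat.of R (P × Q t), inferInstance, E.map i x₀ + E.map i' (x t),
      add_mem (map_mem_spanSub i (spanSub_mono (by simp) _ hx₀))
        (AddSubgroup.subset_closure ⟨t, by simp, i', rfl⟩), fun S y hy => ?_⟩
    have hsum : ∀ (f : P ⟶ S) (g : Q t ⟶ S), ∃ h : ModuleCat.of R (P × Q t) ⟶ S,
        E.map h (E.map i x₀ + E.map i' (x t)) = E.map f x₀ + E.map g (x t) := by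
      intro f g
      obtain ⟨h, rfl, rfl⟩ := hc f g
      exact ⟨h, by rw [map_add, map_comp_apply, map_comp_apply]⟩
    let H : AddSubgroup (E.obj S) := (AddMonoidHom.mk'
      (fun h : ModuleCat.of R (P × Q t) ⟶ S => E.map h (E.map i x₀ + E.map i' (x t)))
      fun h h' => map_add_apply E h h' _).range
    have hle : spanSub E x (insert t X : Finset T) S ≤ H := by
      refine (AddSubgroup.closure_le _).mpr ?_
      rintro _ ⟨s, hs, f, rfl⟩
      rcases Finset.mem_insert.mp (Finset.mem_coe.mp hs) with rfl | hs
      · obtain ⟨h, hh⟩ := hsum 0 f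
        exact ⟨h, hh.trans (by rw [map_zero_apply, zero_add])⟩
      · obtain ⟨g, hg⟩ := hgen S _ (AddSubgroup.subset_closure ⟨s, Finset.mem_coe.mpr hs, f, rfl⟩)
        obtain ⟨h, hh⟩ := hsum g 0
        exact ⟨h, hh.trans (by rw [map_zero_apply, add_zero, hg])⟩
    exact hle hy

variable (E x)

/-- The quotient of `E` by the subfunctor generated by the elements `x t` with `t ∈ X`. -/
def spanQuot (X : Set T) : ModuleCat.{u} R ⥤ AddCommGrpCat.{u} where
  obj S := AddCommGrpCat.of (E.obj S ⧸ spanSub E x X S)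
  map f := AddCommGrpCat.ofHom (QuotientAddGroup.map _ _ (E.map f).hom
    fun _ hy => map_mem_spanSub f hy)
  map_id _ := AddCommGrpCat.hom_ext (QuotientAddGroup.addMonoidHom_ext _ (AddMonoidHom.ext fun y =>
    congrArg _ (map_id_apply E y)))
  map_comp f g := AddCommGrpCat.hom_ext (QuotientAddGroup.addMonoidHom_ext _
    (AddMonoidHom.ext fun y => congrArg _ (map_comp_apply E f g y)))

instance [E.Additive] (X : Set T) : (spanQuot E x X).Additive where
  map_add {_ _ f g} := AddCommGrpCat.hom_ext (QuotientAddGroup.addMonoidHom_ext _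
    (AddMonoidHom.ext fun y => congrArg _ (map_add_apply E f g y)))

/-- The projection of `E` to a quotient. -/
def spanMk (X : Set T) (S : ModuleCat.{u} R) : E.obj S →+ (spanQuot E x X).obj S :=
  QuotientAddGroup.mk' (spanSub E x X S)

theorem spanMk_surjective (X : Set T) (S : ModuleCat.{u} R) :
    Function.Surjective (spanMk E x X S) :=
  QuotientAddGroup.mk'_surjective _

theorem spanMk_eq_zero {X : Set T} {S : ModuleCat.{u} R} {y : E.obj S} :
    spanMk E x X S y = 0 ↔ y ∈ spanSub E x X S :=
  QuotientAddGroup.eq_zero_iff _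

theorem spanQuot_map_mk (X : Set T) {S S' : ModuleCat.{u} R} (f : S ⟶ S') (y : E.obj S) :
    (spanQuot E x X).map f (spanMk E x X S y) = spanMk E x X S' (E.map f y) := rfl

theorem spanQuot_hom_ext {X : Set T} {G : ModuleCat.{u} R ⥤ AddCommGrpCat.{u}}
    {a b : spanQuot E x X ⟶ G}
    (h : ∀ S y, a.app S (spanMk E x X S y) = b.app S (spanMk E x X S y)) : a = b :=
  NatTrans.ext (funext fun S => AddCommGrpCat.hom_ext
    (QuotientAddGroup.addMonoidHom_ext _ (AddMonoidHom.ext fun y => h S y)))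

/-- The projections between the quotients of `E`. -/
def spanProj {X Y : Set T} (h : X ⊆ Y) : spanQuot E x X ⟶ spanQuot E x Y where
  app S := AddCommGrpCat.ofHom (QuotientAddGroup.map _ _ (AddMonoidHom.id _)
    fun _ hy => spanSub_mono h S hy)
  naturality _ _ _ := AddCommGrpCat.hom_ext (QuotientAddGroup.addMonoidHom_ext _ rfl)

theorem spanProj_mk {X Y : Set T} (h : X ⊆ Y) (S : ModuleCat.{u} R) (y : E.obj S) :
    (spanProj E x h).app S (spanMk E x X S y) = spanMk E x Y S y := rfl

theorem spanProj_refl (X : Set T) (h : X ⊆ X) : spanProj E x h = 𝟙 _ :=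
  spanQuot_hom_ext E x fun S y => spanProj_mk E x h S y

theorem spanProj_comp {X Y Z : Set T} (h : X ⊆ Y) (h' : Y ⊆ Z) :
    spanProj E x h ≫ spanProj E x h' = spanProj E x (h.trans h') :=
  spanQuot_hom_ext E x fun S y => (congrArg ((spanProj E x h').app S) (spanProj_mk E x h S y)).trans
    ((spanProj_mk E x h' S y).trans (spanProj_mk E x (h.trans h') S y).symm)

/-- The directed system of the quotients of `E` by finitely generated subfunctors. -/
def spanSystem : Finset T ⥤ ModuleCat.{u} R ⥤ AddCommGrpCat.{u} where
  obj X := spanQuot E x X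
  map h := spanProj E x (Finset.coe_subset.mpr h.le)
  map_id _ := spanProj_refl E x _ _
  map_comp _ _ := (spanProj_comp E x _ _).symm

/-- The quotient of `E` by all `x t`, as a cocone over the quotients by finitely many of them. -/
def spanCocone : Cocone (spanSystem E x) where
  pt := spanQuot E x Set.univ
  ι :=
    { app := fun _ => spanProj E x (Set.subset_univ _)
      naturality := fun _ _ f => (spanProj_comp E x (Finset.coe_subset.mpr f.le) _).trans
        (Category.comp_id (spanProj E x (Set.subset_univ _))).symm }

theorem nonempty_isColimit_spanCocone : Nonempty (IsColimit (spanCocone E x)) := by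
  classical
  refine ⟨evaluationJointlyReflectsColimits _ fun S => Nonempty.some
    (IsDirectedColimit.nonempty_isColimit ⟨fun y => ?_, fun X y hy => ?_⟩)⟩
  · obtain ⟨y, rfl⟩ := spanMk_surjective E x _ S y
    exact ⟨∅, spanMk E x _ S y, rfl⟩
  · obtain ⟨y, rfl⟩ := spanMk_surjective E x _ S y
    obtain ⟨Y, hY⟩ := exists_finset_mem_spanSub ((spanMk_eq_zero E x).mp hy)
    refine ⟨X ∪ Y, Finset.subset_union_left, (spanMk_eq_zero E x).mpr ?_⟩
    exact spanSub_mono (Finset.coe_subset.mpr Finset.subset_union_right) _ hY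

theorem HomCommutesWithDirectLimits.isDirectedColimit {F : ModuleCat.{u} R ⥤ AddCommGrpCat.{u}}
    (hF : HomCommutesWithDirectLimits F) [E.Additive] :
    IsDirectedColimit ((preadditiveCoyoneda.obj (Opposite.op F)).mapCocone (spanCocone E x)) := by
  have := hF (Finset T) (spanSystem E x) fun X => inferInstanceAs (spanQuot E x X).Additive
  exact .of_isColimit.{u, u + 1} (isColimitOfPreserves _ (nonempty_isColimit_spanCocone E x).some)

end Span

/-! ### Functors whose morphisms commute with direct limits preserve direct products -/

section Retract

variable {R : Type u} [Ring R] {F : ModuleCat.{u} R ⥤ AddCommGrpCat.{u}}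

/-- If `Hom(F, -)` commutes with direct limits, then `F` is generated by one element of its value
at a finitely presented module: the quotients of `F` by its finitely generated subfunctors
have direct limit zero, hence one of the projections vanishes. -/
theorem HomCommutesWithDirectLimits.exists_generator [F.Additive]
    (hF : HomCommutesWithDirectLimits F) (hd : DeterminedByFP F) :
    ∃ (P : ModuleCat.{u} R) (_ : Module.FinitePresentation R P) (x₀ : F.obj P),
      ∀ (S : ModuleCat.{u} R) (m : F.obj S), ∃ h : P ⟶ S, F.map h x₀ = m := by
  let Q : (Σ i : FPIndex R, F.obj (fpMod i)) → ModuleCat.{u} R := fun t => fpMod t.1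
  let x : ∀ t, F.obj (Q t) := fun t => t.2
  have htop : ∀ S (m : F.obj S), m ∈ spanSub F x Set.univ S := by
    intro S m
    obtain ⟨P, hP, f, y, rfl⟩ := hd.lift S m
    obtain ⟨i, ⟨e⟩⟩ := exists_iso_fpMod hP
    refine AddSubgroup.subset_closure ⟨⟨i, F.map e.hom y⟩, trivial, e.inv ≫ f, ?_⟩
    change F.map (e.inv ≫ f) (F.map e.hom y) = _
    rw [← map_comp_apply, e.hom_inv_id_assoc]
  let π : F ⟶ (spanSystem F x).obj ∅ :=
    Hom.toNatTrans ⟨fun S => spanMk F x _ S, fun f m => rfl⟩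
  obtain ⟨X, hX, h0⟩ := (hF.isDirectedColimit F x).zero ∅ π
    (NatTrans.ext (funext fun S => AddCommGrpCat.hom_ext (AddMonoidHom.ext fun m =>
      (spanMk_eq_zero F x).mpr (htop S m))))
  obtain ⟨P, hP, x₀, -, hx₀⟩ := exists_generator_spanSub (E := F) (x := x)
    (fun t => finitePresentation_fpMod t.1) X
  refine ⟨P, hP, x₀, fun S m => hx₀ S m ((spanMk_eq_zero F x).mp ?_)⟩
  exact congrArg (fun β : F ⟶ spanQuot F x X => β.app S m) h0

theorem ProductsBijective.of_retract {G : ModuleCat.{u} R ⥤ AddCommGrpCat.{u}}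
    (hG : ProductsBijective G) (s : Hom F G) (p : Hom G F) (hps : ∀ S m, p.app S (s.app S m) = m) :
    ProductsBijective F := by
  intro I S
  constructor
  · intro m m' h
    rw [← hps _ m, ← hps _ m']
    refine congrArg _ ((hG I S).1 (funext fun i => ?_))
    exact (s.naturality _ _).symm.trans ((congrArg _ (congrFun h i)).trans (s.naturality _ _))
  · intro m
    obtain ⟨g, hg⟩ := (hG I S).2 fun i => s.app (S i) (m i)
    refine ⟨p.app _ g, funext fun i => ?_⟩
    refine (p.naturality _ _).symm.trans ?_
    exact (congrArg _ (congrFun hg i)).trans (hps _ _)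

/-- Let `E` be represented by `P` with universal element `e`. If `Hom(F, -)` commutes with direct
limits and `F` is generated by `x₀ ∈ F(P)`, then `F` preserves direct products: as a
quotient of `E` it is the direct limit of the quotients by finitely generated subfunctors,
which are coherent, and its identity factors through one of them. -/
theorem HomCommutesWithDirectLimits.productsBijective_of_generator [F.Additive]
    (hF : HomCommutesWithDirectLimits F) (hd : DeterminedByFP F) {P : ModuleCat.{u} R}
    (hP : Module.FinitePresentation R P) {x₀ : F.obj P}
    (hx₀ : ∀ (S : ModuleCat.{u} R) (m : F.obj S), ∃ h : P ⟶ S, F.map h x₀ = m)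
    (E : ModuleCat.{u} R ⥤ AddCommGrpCat.{u}) [E.Additive] (e : E.obj P)
    (hE : ∀ S, Function.Bijective fun h : P ⟶ S => E.map h e) : ProductsBijective F := by
  let θ : ∀ S, (P ⟶ S) ≃+ E.obj S := fun S =>
    AddEquiv.ofBijective (AddMonoidHom.mk' (fun h : P ⟶ S => E.map h e)
      fun h h' => map_add_apply E h h' e) (hE S)
  have hθ : ∀ {S} (h : P ⟶ S), θ S h = E.map h e := fun h => rfl
  have hθmap : ∀ {S S'} (f : S ⟶ S') (h : P ⟶ S), E.map f (θ S h) = θ S' (h ≫ f) :=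
    fun f h => (map_comp_apply E h f e).symm
  let ev : ∀ S, E.obj S →+ F.obj S := fun S =>
    (AddMonoidHom.mk' (fun h : P ⟶ S => F.map h x₀) fun h h' => map_add_apply F h h' x₀).comp
      (θ S).symm.toAddMonoidHom
  have hev : ∀ {S} (h : P ⟶ S), ev S (θ S h) = F.map h x₀ := fun {S} h =>
    congrArg (fun h => F.map h x₀) ((θ S).symm_apply_apply h)
  have hevmap : ∀ {S S'} (f : S ⟶ S') (y : E.obj S), ev S' (E.map f y) = F.map f (ev S y) := by
    intro S S' f y
    obtain ⟨h, rfl⟩ := (θ S).surjective y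
    rw [hθmap, hev, hev, map_comp_apply]
  let Q : (Σ i : FPIndex R, relSubgroup F x₀ (fpMod i)) → ModuleCat.{u} R := fun t => fpMod t.1
  let x : ∀ t, E.obj (Q t) := fun t => θ (Q t) t.2.1
  have hle : ∀ (X : Set (Σ i : FPIndex R, relSubgroup F x₀ (fpMod i))) (S : ModuleCat.{u} R),
      spanSub E x X S ≤ (ev S).ker := by
    intro X S
    refine (AddSubgroup.closure_le _).mpr ?_
    rintro _ ⟨t, -, f, rfl⟩
    refine (hevmap f (x t)).trans ?_
    rw [hev, mem_relSubgroup.mp t.2.2, map_zero]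
  have hge : ∀ {S} (y : E.obj S), ev S y = 0 → y ∈ spanSub E x Set.univ S := by
    intro S y h0
    obtain ⟨h, rfl⟩ := (θ S).surjective y
    rw [hev] at h0
    obtain ⟨P', hP', g, k, rfl, hg⟩ := hd.zero P S hP h x₀ h0
    obtain ⟨i, ⟨j⟩⟩ := exists_iso_fpMod hP'
    refine AddSubgroup.subset_closure ⟨⟨i, ⟨g ≫ j.hom, ?_⟩⟩, trivial, j.inv ≫ k, ?_⟩
    · rw [mem_relSubgroup, map_comp_apply, hg, map_zero]
    · refine (hθmap (j.inv ≫ k) (g ≫ j.hom)).trans ?_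
      rw [Category.assoc, j.hom_inv_id_assoc]
  have hmk : ∀ {S} {y y' : E.obj S}, ev S y = ev S y' →
      spanMk E x Set.univ S y = spanMk E x Set.univ S y' := by
    intro S y y' h
    rw [← sub_eq_zero, ← map_sub]
    refine (spanMk_eq_zero E x).mpr (hge (y - y') ?_)
    rw [map_sub, h, sub_self]
  have hevs : ∀ S (m : F.obj S), ∃ y, ev S y = m := fun S m => by
    obtain ⟨h, hh⟩ := hx₀ S m
    exact ⟨θ S h, (hev h).trans hh⟩
  choose r hr using hevs
  -- the inverse of the isomorphism from the quotient of `E` by all relations to `F`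
  obtain ⟨α, hα⟩ : ∃ α : F ⟶ spanQuot E x Set.univ,
      ∀ S m, α.app S m = spanMk E x Set.univ S (r S m) :=
    ⟨Hom.toNatTrans
      { app := fun S => AddMonoidHom.mk' (fun m => spanMk E x Set.univ S (r S m)) fun m m' => by
          rw [← map_add]
          exact hmk (by rw [hr, map_add, hr, hr])
        naturality := fun {S S'} f m => by
          refine Eq.trans (hmk ?_) (spanQuot_map_mk E x Set.univ f (r S m)).symm
          rw [hr, hevmap, hr] }, fun _ _ => rfl⟩
  obtain ⟨X, s, hs⟩ : ∃ (X : Finset (Σ i : FPIndex R, relSubgroup F x₀ (fpMod i)))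
      (s : F ⟶ spanQuot E x X), s ≫ spanProj E x (Set.subset_univ _) = α :=
    (hF.isDirectedColimit E x).surj α
  have hcoh : IsCoherent (spanQuot E x X) := by
    obtain ⟨P₁, h₁, y, hy, hgen⟩ := exists_generator_spanSub (E := E) (x := x)
      (fun t => finitePresentation_fpMod t.1) X
    obtain ⟨φ, rfl⟩ := (θ P₁).surjective y
    refine ⟨P₁, P, h₁, hP, φ, spanMk E x X P e, fun S m => ?_, fun S h => ?_⟩
    · obtain ⟨y, rfl⟩ := spanMk_surjective E x _ S m
      obtain ⟨h, rfl⟩ := (θ S).surjective y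
      exact ⟨h, rfl⟩
    · rw [spanQuot_map_mk, ← hθ, spanMk_eq_zero]
      constructor
      · intro h0
        obtain ⟨g, hg⟩ := hgen S _ h0
        exact ⟨g, (θ S).injective ((hθmap g φ).symm.trans hg)⟩
      · rintro ⟨g, rfl⟩
        rw [← hθmap]
        exact map_mem_spanSub g hy
  obtain ⟨p, hp⟩ : ∃ p : Hom (spanQuot E x X) F, ∀ S y, p.app S (spanMk E x X S y) = ev S y :=
    ⟨{ app := fun S => QuotientAddGroup.lift (spanSub E x X S) (ev S) (hle X S)
       naturality := fun {S S'} f m => by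
        obtain ⟨y, rfl⟩ := spanMk_surjective E x _ S m
        exact hevmap f y }, fun _ _ => rfl⟩
  refine ProductsBijective.of_retract hcoh.hasTensorCopresentation.productsBijective
    (Hom.ofNatTrans s) p fun S m => ?_
  obtain ⟨y, hy⟩ := spanMk_surjective E x _ S (s.app S m)
  refine (congrArg (p.app S) hy.symm).trans ((hp S y).trans ?_)
  have h1 : spanMk E x Set.univ S y = spanMk E x Set.univ S (r S m) := by
    rw [← hα, ← hs, ← spanProj_mk E x (Set.subset_univ (X : Set _)), hy]
    rfl
  have h2 : y - r S m ∈ spanSub E x Set.univ S := by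
    rw [← spanMk_eq_zero, map_sub, h1, sub_self]
  have h3 : ev S (y - r S m) = 0 := hle _ S h2
  rw [map_sub, sub_eq_zero] at h3
  exact h3.trans (hr S m)

theorem HomCommutesWithDirectLimits.productsBijective [F.Additive]
    (hF : HomCommutesWithDirectLimits F) (hd : DeterminedByFP F) : ProductsBijective F := by
  obtain ⟨P, hP, x₀, hx₀⟩ := hF.exists_generator hd
  refine hF.productsBijective_of_generator hd hP hx₀ (preadditiveCoyoneda.obj (Opposite.op P))
    (𝟙 P) fun S => ?_
  have : (fun h : P ⟶ S => 𝟙 P ≫ h) = id := funext Category.id_comp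
  exact this ▸ Function.bijective_id

end Retract

end ModuleFunctor

end

theorem mainTheorem1 {R : Type u} [Ring R] (F : ModuleCat.{u} R ⥤ AddCommGrpCat.{u})
    [F.Additive] (hF : ModuleFunctor.PreservesDirectLimits F) :
    List.TFAE
      [ModuleFunctor.PreservesDirectProducts F,
       ModuleFunctor.HomCommutesWithDirectLimits F,
       ModuleFunctor.IsReflexive F ∧
         ModuleFunctor.PreservesDirectLimits (ModuleFunctor.dualOfLeft F),
       ModuleFunctor.HasDualPresentation F,
       ModuleFunctor.HasTensorCopresentation F] := by
  have hd : ModuleFunctor.DeterminedByFP F :=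
    ModuleFunctor.PreservesDirectLimits.determinedByFP.{u, u} hF
  tfae_have 1 → 4 := fun h =>
    ModuleFunctor.hasDualPresentation_iff.mpr (h.bijective.isCoherent hd)
  tfae_have 4 → 5 := fun h =>
    (ModuleFunctor.hasDualPresentation_iff.mp h).hasTensorCopresentation
  tfae_have 5 → 1 := fun h => h.productsBijective.preserves
  tfae_have 4 → 2 := fun h => (ModuleFunctor.hasDualPresentation_iff.mp h).homCommutes
  tfae_have 2 → 1 := fun h => (h.productsBijective hd).preserves
  tfae_have 4 → 3 := fun h =>
    have hc := ModuleFunctor.hasDualPresentation_iff.mp h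
    ⟨hc.isReflexive, hc.dual.preservesDirectLimits⟩
  tfae_have 3 → 1 := fun h => (h.1.productsBijective
    (ModuleFunctor.PreservesDirectLimits.determinedByFP.{u, u + 1} h.2)).preserves
  tfae_finish
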